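/- Let $H$ and $K$ be complex Hilbert spaces and let $X$ on $H$ and $Y$ on $K$ be arbitrary (possibly unbounded) self-adjoint operators, with spectral measures $E^X$ and $E^Y$. Let $X\otimes Y$ denote the closure, in the Hilbert space tensor product $H\otimes K$, of the operator $\psi\otimes\phi\mapsto X\psi\otimes Y\phi$ defined on the algebraic tensor product of the domains $D(X)$ and $D(Y)$. Then $X\otimes Y$ is self-adjoint, and $$e^{-iX\otimes Y}=\int_{\operatorname{Spec} Y} e^{-iyX}\otimes dE^Y(y)$$ in the weak sense. That is, $e^{-iX\otimes Y}$ is the unique bounded operator $T$ on $H\otimes K$ such that, for all $\psi_1,\psi_2\in H$ and $\phi_1,\phi_2\in K$, the function $y\mapsto\langle\psi_1,e^{-iyX}\psi_2\rangle$ is integrable over the Borel set $\operatorname{Spec}Y$ with respect to the complex measure $\langle\phi_1,E^Y(\cdot)\phi_2\rangle$ and $$\langle\psi_1\otimes\phi_1,\,T(\psi_2\otimes\phi_2)\rangle=\int_{\operatorname{Spec}Y}\langle\psi_1,e^{-iyX}\psi_2\rangle\,d\langle\phi_1,E^Y(y)\phi_2\rangle .$$ Here, for a self-adjoint operator $A$,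 $e^{-itA}=\int e^{-itx}\,dE^A(x)$. -/

import Mathlib

open MeasureTheory
open scoped TensorProduct InnerProductSpace ENNReal

noncomputable section

universe u v

/-- A projection-valued measure on the Borel sets of `ℝ`, acting on `H`: orthogonal projections
`E Δ` with `E ℝ = 1` that are countably additive in the strong operator topology
(non-Borel sets get the value `0`, as for `MeasureTheory.VectorMeasure`). -/
structure PVM (H : Type u) [NormedAddCommGroup H] [InnerProductSpace ℂ H] [CompleteSpace H] where
  proj : Set ℝ → H →L[ℂ] H
  isStarProjection : ∀ Δ, IsStarProjection (proj Δ)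
  not_measurable : ∀ Δ, ¬ MeasurableSet Δ → proj Δ = 0
  proj_univ : proj Set.univ = 1
  hasSum_iUnion : ∀ f : ℕ → Set ℝ, (∀ n, MeasurableSet (f n)) →
    Pairwise (Function.onFun Disjoint f) →
    ∀ φ : H, HasSum (fun n => proj (f n) φ) (proj (⋃ n, f n) φ)

namespace PVM

variable {H : Type u} [NormedAddCommGroup H] [InnerProductSpace ℂ H] [CompleteSpace H]

lemma proj_empty (E : PVM H) : E.proj ∅ = 0 := by
  ext φ
  have h := E.hasSum_iUnion (fun _ => ∅) (fun _ => MeasurableSet.empty)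
    (fun _ _ _ => disjoint_bot_left) φ
  have h0 := h.summable.tendsto_atTop_zero
  exact tendsto_nhds_unique tendsto_const_nhds h0

lemma inner_proj (E : PVM H) (Δ : Set ℝ) (ψ φ : H) :
    inner ℂ ψ (E.proj Δ φ) = inner ℂ (E.proj Δ ψ) (E.proj Δ φ) := by
  have h1 : E.proj Δ (E.proj Δ φ) = E.proj Δ φ := by
    have := (E.isStarProjection Δ).isIdempotentElem
    exact congrArg (fun T : H →L[ℂ] H => T φ) this
  have h2 : ContinuousLinearMap.adjoint (E.proj Δ) = E.proj Δ :=
    (E.isStarProjection Δ).isSelfAdjoint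
  conv_lhs => rw [← h1, ← ContinuousLinearMap.adjoint_inner_left, h2]

lemma inner_proj_self (E : PVM H) (Δ : Set ℝ) (φ : H) :
    inner ℂ φ (E.proj Δ φ) = ((‖E.proj Δ φ‖ ^ 2 : ℝ) : ℂ) := by
  rw [inner_proj, inner_self_eq_norm_sq_to_K]; simp

/-- The complex measure `Δ ↦ ⟨ψ, E(Δ) φ⟩`. -/
def matrixElement (E : PVM H) (ψ φ : H) : ComplexMeasure ℝ where
  measureOf' Δ := inner ℂ ψ (E.proj Δ φ)
  empty' := by simp [proj_empty]
  not_measurable' Δ h := by simp [E.not_measurable Δ h]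
  m_iUnion' f hf hd := (E.hasSum_iUnion f hf hd φ).mapL (innerSL ℂ ψ)

lemma matrixElement_apply (E : PVM H) (ψ φ : H) (Δ : Set ℝ) :
    E.matrixElement ψ φ Δ = inner ℂ ψ (E.proj Δ φ) := rfl

/-- The positive measure `Δ ↦ ⟨φ, E(Δ) φ⟩ = ‖E(Δ) φ‖²`. -/
def scalarMeasure (E : PVM H) (φ : H) : Measure ℝ :=
  Measure.ofMeasurable (fun Δ _ => ENNReal.ofReal (‖E.proj Δ φ‖ ^ 2))
    (by simp [proj_empty])
    (by
      intro f hf hd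
      have h := (E.matrixElement φ φ).m_iUnion hf hd
      simp only [matrixElement_apply, inner_proj_self] at h
      have h' : HasSum (fun n => ‖E.proj (f n) φ‖ ^ 2) (‖E.proj (⋃ n, f n) φ‖ ^ 2) := by
        exact_mod_cast h
      rw [← h'.tsum_eq, ENNReal.ofReal_tsum_of_nonneg (fun n => by positivity) h'.summable])

lemma scalarMeasure_apply (E : PVM H) (φ : H) {Δ : Set ℝ} (hΔ : MeasurableSet Δ) :
    E.scalarMeasure φ Δ = ENNReal.ofReal (‖E.proj Δ φ‖ ^ 2) :=
  Measure.ofMeasurable_apply Δ hΔ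

lemma scalarMeasure_univ (E : PVM H) (φ : H) :
    E.scalarMeasure φ Set.univ = ENNReal.ofReal (‖φ‖ ^ 2) := by
  rw [scalarMeasure_apply E φ MeasurableSet.univ, E.proj_univ]; rfl

instance (E : PVM H) (φ : H) : IsFiniteMeasure (E.scalarMeasure φ) :=
  ⟨by rw [scalarMeasure_univ]; exact ENNReal.ofReal_lt_top⟩

lemma variation_matrixElement_le (E : PVM H) (ψ φ : H) :
    (E.matrixElement ψ φ).variation ≤ E.scalarMeasure ψ + E.scalarMeasure φ := by
  apply VectorMeasure.variation_le_of_forall_enorm_le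
  intro s hs
  rw [Measure.add_apply, scalarMeasure_apply E ψ hs, scalarMeasure_apply E φ hs,
    ← ENNReal.ofReal_add (by positivity) (by positivity), ← ofReal_norm]
  apply ENNReal.ofReal_le_ofReal
  rw [matrixElement_apply, inner_proj]
  refine (norm_inner_le_norm _ _).trans ?_
  nlinarith [sq_nonneg (‖E.proj s ψ‖ - ‖E.proj s φ‖), sq_nonneg ‖E.proj s ψ‖,
    sq_nonneg ‖E.proj s φ‖]

instance (E : PVM H) (ψ φ : H) : IsFiniteMeasure (E.matrixElement ψ φ).variation :=
  isFiniteMeasure_of_le _ (E.variation_matrixElement_le ψ φ)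

/-- The scalar integral `∫ f(x) d⟨ψ, E(x) φ⟩`. -/
def form (E : PVM H) (f : ℝ → ℂ) (ψ φ : H) : ℂ :=
  (E.matrixElement ψ φ).integral f (ContinuousLinearMap.mul ℝ ℂ)

lemma integrable_of_bounded (E : PVM H) {f : ℝ → ℂ} (hf : Measurable f) {C : ℝ}
    (hC : ∀ x, ‖f x‖ ≤ C) (ψ φ : H) : (E.matrixElement ψ φ).Integrable f :=
  MeasureTheory.Integrable.of_bound hf.aestronglyMeasurable C (Filter.Eventually.of_forall hC)

lemma form_add_right (E : PVM H) {f : ℝ → ℂ} (hf : Measurable f) {C : ℝ}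
    (hC : ∀ x, ‖f x‖ ≤ C) (ψ φ χ : H) :
    E.form f ψ (φ + χ) = E.form f ψ φ + E.form f ψ χ := by
  have h : E.matrixElement ψ (φ + χ) = E.matrixElement ψ φ + E.matrixElement ψ χ := by
    ext Δ _
    simp [matrixElement_apply]
  rw [form, h, VectorMeasure.integral_add_vectorMeasure (E.integrable_of_bounded hf hC _ _)
    (E.integrable_of_bounded hf hC _ _)]
  rfl

lemma form_add_left (E : PVM H) {f : ℝ → ℂ} (hf : Measurable f) {C : ℝ}
    (hC : ∀ x, ‖f x‖ ≤ C) (ψ χ φ : H) :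
    E.form f (ψ + χ) φ = E.form f ψ φ + E.form f χ φ := by
  have h : E.matrixElement (ψ + χ) φ = E.matrixElement ψ φ + E.matrixElement χ φ := by
    ext Δ _
    simp [matrixElement_apply]
  rw [form, h, VectorMeasure.integral_add_vectorMeasure (E.integrable_of_bounded hf hC _ _)
    (E.integrable_of_bounded hf hC _ _)]
  rfl

lemma integral_smul_complexMeasure (ν : ComplexMeasure ℝ) (f : ℝ → ℂ) (hf : ν.Integrable f)
    (z : ℂ) : (z • ν).integral f (ContinuousLinearMap.mul ℝ ℂ)
      = z * ν.integral f (ContinuousLinearMap.mul ℝ ℂ) := by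
  set B := ContinuousLinearMap.mul ℝ ℂ
  have hle : (z • ν).variation ≤ (‖z‖₊ : ℝ≥0∞) • ν.variation := by
    rw [VectorMeasure.variation_smul]; exact le_rfl
  have hT := dominatedFinMeasAdditive_cbmApplyMeasure ν B
  have hT' : DominatedFinMeasAdditive ν.variation ((z • ν).transpose B) (‖z‖ * ‖B‖) := by
    refine ⟨fun s t hs ht _ _ hdisj => cbmApplyMeasure_union (z • ν) B hs ht hdisj, fun s hs hsf => ?_⟩
    refine (norm_cbmApplyMeasure_le (z • ν) B s).trans ?_
    have h1 : ‖(z • ν) s‖ = ‖z‖ * ‖ν s‖ := by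
      rw [smul_apply, norm_smul]
    have h2 : ‖ν s‖ ≤ ν.variation.real s := VectorMeasure.norm_measure_le_variation hsf.ne
    calc ‖B‖ * ‖(z • ν) s‖ = (‖z‖ * ‖B‖) * ‖ν s‖ := by rw [h1]; ring
      _ ≤ (‖z‖ * ‖B‖) * ν.variation.real s := by gcongr
  have e1 : (z • ν).integral f B = setToFun ν.variation ((z • ν).transpose B) hT' f :=
    (setToFun_congr_measure_of_integrable _ ENNReal.coe_ne_top hle hT'
      (dominatedFinMeasAdditive_cbmApplyMeasure (z • ν) B) f hf).symm
  have e2 : ν.integral f B = setToFun ν.variation (ν.transpose B) hT f := rfl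
  rw [e1, e2]
  refine MeasureTheory.Integrable.induction
    (P := fun f => setToFun ν.variation ((z • ν).transpose B) hT' f
      = z * setToFun ν.variation (ν.transpose B) hT f) ?_ ?_ ?_ ?_ hf
  · intro c s hs hsf
    rw [setToFun_indicator_const hT' hs hsf.ne, setToFun_indicator_const hT hs hsf.ne]
    change c * (z • ν) s = z * (c * ν s)
    rw [smul_apply, smul_eq_mul]; ring
  · intro f g _ hf hg h1 h2
    rw [setToFun_add hT' hf hg, setToFun_add hT hf hg, h1, h2, mul_add]
  · exact isClosed_eq (continuous_setToFun hT') ((continuous_setToFun hT).const_mul z)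
  · intro f g hfg _ h
    rw [← setToFun_congr_ae hT' hfg, ← setToFun_congr_ae hT hfg, h]

lemma form_smul_right (E : PVM H) {f : ℝ → ℂ} (hf : Measurable f) {C : ℝ}
    (hC : ∀ x, ‖f x‖ ≤ C) (z : ℂ) (ψ φ : H) :
    E.form f ψ (z • φ) = z * E.form f ψ φ := by
  have h : E.matrixElement ψ (z • φ) = z • E.matrixElement ψ φ := by
    ext Δ _
    simp [matrixElement_apply]
  rw [form, h, integral_smul_complexMeasure _ _ (E.integrable_of_bounded hf hC _ _)]
  rfl

lemma form_smul_left (E : PVM H) {f : ℝ → ℂ} (hf : Measurable f) {C : ℝ}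
    (hC : ∀ x, ‖f x‖ ≤ C) (z : ℂ) (ψ φ : H) :
    E.form f (z • ψ) φ = starRingEnd ℂ z * E.form f ψ φ := by
  have h : E.matrixElement (z • ψ) φ = starRingEnd ℂ z • E.matrixElement ψ φ := by
    ext Δ _
    simp [matrixElement_apply, mul_comm]
  rw [form, h, integral_smul_complexMeasure _ _ (E.integrable_of_bounded hf hC _ _)]
  rfl

lemma norm_form_le_add (E : PVM H) {f : ℝ → ℂ} {C : ℝ} (hC : ∀ x, ‖f x‖ ≤ C) (ψ φ : H) :
    ‖E.form f ψ φ‖ ≤ C * (‖ψ‖ ^ 2 + ‖φ‖ ^ 2) := by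
  have hC0 : 0 ≤ C := (norm_nonneg _).trans (hC 0)
  have h1 : ‖E.form f ψ φ‖ ≤ C * ‖ContinuousLinearMap.mul ℝ ℂ‖ *
      (E.matrixElement ψ φ).variation.real Set.univ :=
    VectorMeasure.norm_integral_le_of_norm_le_const (Filter.Eventually.of_forall hC)
  have h2 : (E.matrixElement ψ φ).variation.real Set.univ ≤ ‖ψ‖ ^ 2 + ‖φ‖ ^ 2 := by
    refine ENNReal.toReal_le_of_le_ofReal (by positivity) ?_
    refine (E.variation_matrixElement_le ψ φ Set.univ).trans ?_
    rw [Measure.add_apply, scalarMeasure_univ, scalarMeasure_univ,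
      ENNReal.ofReal_add (by positivity) (by positivity)]
  rw [ContinuousLinearMap.opNorm_mul, mul_one] at h1
  exact h1.trans (by gcongr)

lemma norm_form_le (E : PVM H) {f : ℝ → ℂ} (hf : Measurable f) {C : ℝ}
    (hC : ∀ x, ‖f x‖ ≤ C) (ψ φ : H) : ‖E.form f ψ φ‖ ≤ 2 * C * ‖ψ‖ * ‖φ‖ := by
  rcases eq_or_ne ψ 0 with rfl | hψ
  · have := E.form_smul_left hf hC 0 0 φ
    simp_all
  rcases eq_or_ne φ 0 with rfl | hφ
  · have := E.form_smul_right hf hC 0 ψ 0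
    simp_all
  have hψ' : 0 < ‖ψ‖ := norm_pos_iff.2 hψ
  have hφ' : 0 < ‖φ‖ := norm_pos_iff.2 hφ
  have h := E.norm_form_le_add hC (((‖ψ‖⁻¹ : ℝ) : ℂ) • ψ) (((‖φ‖⁻¹ : ℝ) : ℂ) • φ)
  rw [E.form_smul_left hf hC, E.form_smul_right hf hC] at h
  simp only [norm_mul, RCLike.norm_conj, norm_smul, Complex.norm_real, norm_inv, norm_norm] at h
  rw [inv_mul_cancel₀ hψ'.ne', inv_mul_cancel₀ hφ'.ne'] at h
  have h3 : ‖E.form f ψ φ‖ = ‖ψ‖ * ‖φ‖ * (‖ψ‖⁻¹ * (‖φ‖⁻¹ * ‖E.form f ψ φ‖)) := by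
    field_simp
  rw [h3]
  calc ‖ψ‖ * ‖φ‖ * (‖ψ‖⁻¹ * (‖φ‖⁻¹ * ‖E.form f ψ φ‖)) ≤ ‖ψ‖ * ‖φ‖ * (C * (1 ^ 2 + 1 ^ 2)) := by
        gcongr
    _ = 2 * C * ‖ψ‖ * ‖φ‖ := by ring

/-- The bounded operator `f(E) = ∫ f(x) dE(x)` of a bounded Borel function `f`, that is, the
operator with `⟨ψ, f(E) φ⟩ = ∫ f(x) d⟨ψ, E(x) φ⟩` for all `ψ, φ` (see `inner_integral`). -/
def integral (E : PVM H) (f : ℝ → ℂ) (hf : Measurable f) (C : ℝ) (hC : ∀ x, ‖f x‖ ≤ C) :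
    H →L[ℂ] H :=
  ContinuousLinearMap.adjoint (InnerProductSpace.continuousLinearMapOfBilin
    (LinearMap.mkContinuous₂
      (LinearMap.mk₂'ₛₗ (starRingEnd ℂ) (RingHom.id ℂ) (E.form f)
        (fun ψ χ φ => E.form_add_left hf hC ψ χ φ)
        (fun z ψ φ => E.form_smul_left hf hC z ψ φ)
        (fun ψ φ χ => E.form_add_right hf hC ψ φ χ)
        (fun z ψ φ => E.form_smul_right hf hC z ψ φ))
      (2 * C) (fun ψ φ => E.norm_form_le hf hC ψ φ)))

lemma inner_integral (E : PVM H) (f : ℝ → ℂ) (hf : Measurable f) (C : ℝ)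
    (hC : ∀ x, ‖f x‖ ≤ C) (ψ φ : H) :
    inner ℂ ψ (E.integral f hf C hC φ) = E.form f ψ φ := by
  rw [integral, ContinuousLinearMap.adjoint_inner_right,
    InnerProductSpace.continuousLinearMapOfBilin_apply]
  rfl

/-- The projection-valued measure concentrated at `0`. -/
instance : Nonempty (PVM H) := by
  classical
  refine ⟨⟨fun Δ => if MeasurableSet Δ ∧ (0 : ℝ) ∈ Δ then 1 else 0, ?_, ?_, ?_, ?_⟩⟩
  · intro Δ
    split_ifs
    · exact IsStarProjection.one _
    · exact IsStarProjection.zero _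
  · intro Δ h
    simp [h]
  · simp
  · intro f hf hd φ
    by_cases h : ∃ n, (0 : ℝ) ∈ f n
    · obtain ⟨n, hn⟩ := h
      have hU : (0 : ℝ) ∈ ⋃ n, f n := Set.mem_iUnion.2 ⟨n, hn⟩
      simp only [MeasurableSet.iUnion hf, hU, hf, true_and, if_true]
      have := hasSum_single (f := fun m => (if (0 : ℝ) ∈ f m then (1 : H →L[ℂ] H) else 0) φ) n
        (fun m hm => by
          have : (0 : ℝ) ∉ f m := fun h0 => Set.disjoint_left.1 (hd hm) h0 hn
          simp [this])
      simpa [hn] using this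
    · push Not at h
      have hU : (0 : ℝ) ∉ ⋃ n, f n := by simpa using h
      simp [hU, h]

/-- `E` is the spectral measure of `A`, i.e. `A = ∫ x dE(x)` as unbounded operators: the domain of
`A` consists of the `φ` with `∫ x² d⟨φ, E(x) φ⟩ < ∞`, and `⟨φ, A φ⟩ = ∫ x d⟨φ, E(x) φ⟩` there
(which determines `A` by polarization). -/
def IsSpectralMeasureOf (E : PVM H) (A : H →ₗ.[ℂ] H) : Prop :=
  (∀ φ : H, φ ∈ A.domain ↔ MeasureTheory.Integrable (fun x : ℝ => x ^ 2) (E.scalarMeasure φ)) ∧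
  ∀ φ : A.domain, inner ℂ (φ : H) (A φ) = ((∫ x : ℝ, x ∂(E.scalarMeasure φ) : ℝ) : ℂ)

end PVM

section Operators

variable {H : Type u} [NormedAddCommGroup H] [InnerProductSpace ℂ H] [CompleteSpace H]

/-- The spectral measure of a self-adjoint operator `A`, i.e. the projection-valued measure
with `A = ∫ x dE(x)` (it exists and is unique by the spectral theorem). -/
def spectralMeasure (A : H →ₗ.[ℂ] H) : PVM H :=
  Classical.epsilon fun E => E.IsSpectralMeasureOf A

/-- The real points of the spectrum of a (possibly unbounded) operator `A`: the real numbers `y`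
for which `A - y : D(A) → H` has no bounded two-sided inverse. (The spectrum of a self-adjoint
operator is real.) -/
def realSpectrum (A : H →ₗ.[ℂ] H) : Set ℝ :=
  {y | ¬ ∃ R : H →L[ℂ] H,
    (∀ φ : A.domain, R (A φ - (y : ℂ) • (φ : H)) = φ) ∧
    ∀ φ : H, ∃ h : R φ ∈ A.domain, A ⟨R φ, h⟩ - (y : ℂ) • R φ = φ}

/-- The bounded operator `e^{-i t A} = ∫ e^{-i t x} dE^A(x)` for a self-adjoint operator `A`. -/
def expNegI (A : H →ₗ.[ℂ] H) (t : ℝ) : H →L[ℂ] H :=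
  (spectralMeasure A).integral (fun x => Complex.exp (-(Complex.I * t * x)))
    (by fun_prop) 1
    (fun x => by
      rw [show -(Complex.I * t * x) = ((-(t * x) : ℝ) : ℂ) * Complex.I by push_cast; ring,
        Complex.norm_exp_ofReal_mul_I])

end Operators

section Tensor

variable (H : Type u) [NormedAddCommGroup H] [InnerProductSpace ℂ H]
  (K : Type v) [NormedAddCommGroup K] [InnerProductSpace ℂ K]

/-- The Hilbert space tensor product of `H` and `K`. -/
abbrev HilbertTensor : Type (max u v) := UniformSpace.Completion (H ⊗[ℂ] K)

variable {H K}

/-- The elementary tensor `ψ ⊗ φ` in the Hilbert space tensor product. -/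
def hilbertTmul (ψ : H) (φ : K) : HilbertTensor H K :=
  UniformSpace.Completion.toComplₗᵢ (𝕜 := ℂ) (ψ ⊗ₜ[ℂ] φ)

/-- The inclusion of `D(X) ⊗ D(Y)` (algebraic tensor product) in the Hilbert space tensor product. -/
def tensorDomainIncl (X : H →ₗ.[ℂ] H) (Y : K →ₗ.[ℂ] K) :
    X.domain ⊗[ℂ] Y.domain →ₗᵢ[ℂ] HilbertTensor H K :=
  (UniformSpace.Completion.toComplₗᵢ (𝕜 := ℂ)).comp
    (TensorProduct.mapInclIsometry X.domain Y.domain)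

/-- The algebraic tensor product of two operators: its domain is the span of the `ψ ⊗ φ`
with `ψ ∈ D(X)` and `φ ∈ D(Y)`, and it maps `ψ ⊗ φ` to `X ψ ⊗ Y φ`. -/
def algTensor (X : H →ₗ.[ℂ] H) (Y : K →ₗ.[ℂ] K) : HilbertTensor H K →ₗ.[ℂ] HilbertTensor H K where
  domain := LinearMap.range (tensorDomainIncl X Y).toLinearMap
  toFun := (UniformSpace.Completion.toComplₗᵢ (𝕜 := ℂ)).toLinearMap ∘ₗ
    TensorProduct.map X.toFun Y.toFun ∘ₗ
    (LinearEquiv.ofInjective (tensorDomainIncl X Y).toLinearMap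
      (fun _ _ h => (tensorDomainIncl X Y).injective h)).symm.toLinearMap

lemma hilbertTmul_mem_algTensor (X : H →ₗ.[ℂ] H) (Y : K →ₗ.[ℂ] K) (ψ : X.domain) (φ : Y.domain) :
    hilbertTmul (ψ : H) (φ : K) ∈ (algTensor X Y).domain :=
  LinearMap.mem_range.2 ⟨ψ ⊗ₜ[ℂ] φ, rfl⟩

lemma algTensor_hilbertTmul (X : H →ₗ.[ℂ] H) (Y : K →ₗ.[ℂ] K) (ψ : X.domain) (φ : Y.domain) :
    algTensor X Y ⟨hilbertTmul (ψ : H) (φ : K), hilbertTmul_mem_algTensor X Y ψ φ⟩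
      = hilbertTmul (X ψ) (Y φ) := by
  have h : (LinearEquiv.ofInjective (tensorDomainIncl X Y).toLinearMap
      (fun _ _ h => (tensorDomainIncl X Y).injective h)).symm
      ⟨hilbertTmul (ψ : H) (φ : K), hilbertTmul_mem_algTensor X Y ψ φ⟩ = ψ ⊗ₜ[ℂ] φ := by
    rw [LinearEquiv.symm_apply_eq]; rfl
  change UniformSpace.Completion.toComplₗᵢ (𝕜 := ℂ) (TensorProduct.map X.toFun Y.toFun _) = _
  erw [h]
  rfl

/-- The operator `X ⊗ Y` on the Hilbert space tensor product: the closure of the algebraic tensor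
product of `X` and `Y`. -/
def tensorOp (X : H →ₗ.[ℂ] H) (Y : K →ₗ.[ℂ] K) : HilbertTensor H K →ₗ.[ℂ] HilbertTensor H K :=
  (algTensor X Y).closure

/-- `T = ∫_S F(y) ⊗ dE(y)` in the weak sense: `S` is a Borel set, for all `ψ₁, ψ₂ ∈ H` and `φ₁, φ₂ ∈ K` the function
`y ↦ ⟨ψ₁, F(y) ψ₂⟩` is integrable on `S` for the complex measure `⟨φ₁, E(·) φ₂⟩`, and
`⟨ψ₁ ⊗ φ₁, T (ψ₂ ⊗ φ₂)⟩ = ∫_S ⟨ψ₁, F(y) ψ₂⟩ d⟨φ₁, E(y) φ₂⟩`. -/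
def IsWeakTensorIntegral [CompleteSpace K] (F : ℝ → H →L[ℂ] H) (E : PVM K) (S : Set ℝ)
    (T : HilbertTensor H K →L[ℂ] HilbertTensor H K) : Prop :=
  MeasurableSet S ∧ ∀ (ψ₁ ψ₂ : H) (φ₁ φ₂ : K),
    (E.matrixElement φ₁ φ₂).IntegrableOn (fun y => (inner ℂ ψ₁ (F y ψ₂) : ℂ)) S ∧
    inner ℂ (hilbertTmul ψ₁ φ₁) (T (hilbertTmul ψ₂ φ₂)) =
      ((E.matrixElement φ₁ φ₂).restrict S).integral (fun y => (inner ℂ ψ₁ (F y ψ₂) : ℂ))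
        (ContinuousLinearMap.mul ℝ ℂ)

end Tensor

end

open Filter Topology

/-- Induction principle for bounded measurable functions: indicators, sums, and bounded pointwise
limits. -/
theorem bounded_measurable_induction {P : (ℝ → ℂ) → Prop}
    (hind : ∀ (c : ℂ) (Δ : Set ℝ), MeasurableSet Δ → P (Δ.indicator fun _ => c))
    (hadd : ∀ f g : ℝ → ℂ, Measurable f → Measurable g → (∃ C, ∀ x, ‖f x‖ ≤ C) →
      (∃ C, ∀ x, ‖g x‖ ≤ C) → P f → P g → P (f + g))
    (hlim : ∀ (F : ℕ → ℝ → ℂ) (f : ℝ → ℂ) (C : ℝ), (∀ n, Measurable (F n)) →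
      (∀ n x, ‖F n x‖ ≤ C) → (∀ x, Tendsto (fun n => F n x) atTop (𝓝 (f x))) →
      (∀ n, P (F n)) → P f)
    {f : ℝ → ℂ} (hf : Measurable f) {C : ℝ} (hC : ∀ x, ‖f x‖ ≤ C) : P f := by
  have hC0 : 0 ≤ C := (norm_nonneg _).trans (hC 0)
  have hs := hf.stronglyMeasurable
  refine hlim (fun n => hs.approxBounded C n) f C (fun n => SimpleFunc.measurable _)
    (fun n x => hs.norm_approxBounded_le hC0 n x)
    (fun x => hs.tendsto_approxBounded_of_norm_le (hC x)) (fun n => ?_)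
  refine SimpleFunc.induction (motive := fun g : SimpleFunc ℝ ℂ => P g) ?_ ?_ _
  · intro c s hs
    simpa [SimpleFunc.coe_piecewise, SimpleFunc.coe_const, Set.indicator, Set.piecewise,
      Function.const] using! hind c s hs
  · intro f g _ h1 h2
    exact hadd f g f.measurable g.measurable f.exists_forall_norm_le g.exists_forall_norm_le h1 h2

namespace PVM

variable {H : Type u} [NormedAddCommGroup H] [InnerProductSpace ℂ H] [CompleteSpace H]
  (E : PVM H)

lemma proj_apply_proj (Δ : Set ℝ) (φ : H) : E.proj Δ (E.proj Δ φ) = E.proj Δ φ :=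
  congrArg (fun T : H →L[ℂ] H => T φ) (E.isStarProjection Δ).isIdempotentElem

lemma inner_proj_left (Δ : Set ℝ) (ψ φ : H) :
    inner ℂ (E.proj Δ ψ) φ = inner ℂ ψ (E.proj Δ φ) := by
  have h : ContinuousLinearMap.adjoint (E.proj Δ) = E.proj Δ :=
    (E.isStarProjection Δ).isSelfAdjoint
  rw [← ContinuousLinearMap.adjoint_inner_right, h]

lemma norm_proj_apply_le (Δ : Set ℝ) (φ : H) : ‖E.proj Δ φ‖ ≤ ‖φ‖ := by
  have h := (E.proj Δ).le_opNorm φ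
  have h1 := (E.isStarProjection Δ).norm_le
  nlinarith [norm_nonneg φ]

lemma proj_union {A B : Set ℝ} (hA : MeasurableSet A) (hB : MeasurableSet B)
    (h : Disjoint A B) : E.proj (A ∪ B) = E.proj A + E.proj B := by
  ext φ
  refine ext_inner_left ℂ fun ψ => ?_
  have := VectorMeasure.of_union (v := E.matrixElement ψ φ) h hA hB
  simpa [matrixElement_apply, inner_add_right] using this

lemma proj_apply_proj_of_disjoint {A B : Set ℝ} (hA : MeasurableSet A) (hB : MeasurableSet B)
    (h : Disjoint A B) (φ : H) : E.proj A (E.proj B φ) = 0 := by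
  set ψ := E.proj B φ with hψ
  have h1 : inner ℂ ψ (E.proj (A ∪ B) ψ) = ((‖E.proj A ψ‖ ^ 2 + ‖ψ‖ ^ 2 : ℝ) : ℂ) := by
    rw [E.proj_union hA hB h, add_apply, inner_add_right, inner_proj_self,
      inner_proj_self, hψ, proj_apply_proj]
    push_cast
    rfl
  rw [inner_proj_self] at h1
  have h2 : ‖E.proj (A ∪ B) ψ‖ ^ 2 = ‖E.proj A ψ‖ ^ 2 + ‖ψ‖ ^ 2 := by exact_mod_cast h1
  have h3 := E.norm_proj_apply_le (A ∪ B) ψ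
  have h4 : ‖E.proj A ψ‖ ^ 2 ≤ 0 := by nlinarith [norm_nonneg (E.proj (A ∪ B) ψ)]
  exact norm_eq_zero.1 (by nlinarith [norm_nonneg (E.proj A ψ)])

lemma proj_apply_proj_inter {A B : Set ℝ} (hA : MeasurableSet A) (hB : MeasurableSet B) (φ : H) :
    E.proj A (E.proj B φ) = E.proj (A ∩ B) φ := by
  have hA' : E.proj A = E.proj (A ∩ B) + E.proj (A \ B) := by
    rw [← E.proj_union (hA.inter hB) (hA.diff hB) (Set.disjoint_sdiff_inter.symm),
      Set.inter_union_sdiff]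
  have hB' : E.proj B = E.proj (A ∩ B) + E.proj (B \ A) := by
    rw [← E.proj_union (hA.inter hB) (hB.diff hA) (by
      rw [Set.inter_comm]; exact Set.disjoint_sdiff_inter.symm), Set.inter_comm,
      Set.inter_union_sdiff]
  have h1 : E.proj (A \ B) (E.proj B φ) = 0 :=
    E.proj_apply_proj_of_disjoint (hA.diff hB) hB Set.disjoint_sdiff_left φ
  have h2 : E.proj (A ∩ B) (E.proj (B \ A) φ) = 0 :=
    E.proj_apply_proj_of_disjoint (hA.inter hB) (hB.diff hA)
      (Set.disjoint_left.2 fun x hx hx' => hx'.2 hx.1) φ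
  rw [hA', add_apply, h1, add_zero, hB', add_apply,
    map_add, h2, add_zero, proj_apply_proj]

lemma form_indicator_const (c : ℂ) {Δ : Set ℝ} (hΔ : MeasurableSet Δ) (ψ φ : H) :
    E.form (Δ.indicator fun _ => c) ψ φ = c * inner ℂ ψ (E.proj Δ φ) := by
  rw [form, VectorMeasure.integral_indicator_const _ hΔ]
  rfl

lemma form_add_fun {f g : ℝ → ℂ} (hf : Measurable f) (hg : Measurable g)
    (hfb : ∃ C, ∀ x, ‖f x‖ ≤ C) (hgb : ∃ C, ∀ x, ‖g x‖ ≤ C) (ψ φ : H) :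
    E.form (f + g) ψ φ = E.form f ψ φ + E.form g ψ φ := by
  obtain ⟨C, hC⟩ := hfb
  obtain ⟨D, hD⟩ := hgb
  exact VectorMeasure.integral_add (E.integrable_of_bounded hf hC ψ φ)
    (E.integrable_of_bounded hg hD ψ φ)

lemma tendsto_form {F : ℕ → ℝ → ℂ} {f : ℝ → ℂ} {C : ℝ} (hF : ∀ n, Measurable (F n))
    (hC : ∀ n x, ‖F n x‖ ≤ C) (hlim : ∀ x, Tendsto (fun n => F n x) atTop (𝓝 (f x))) (ψ φ : H) :
    Tendsto (fun n => E.form (F n) ψ φ) atTop (𝓝 (E.form f ψ φ)) :=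
  VectorMeasure.tendsto_integral_filter_of_norm_le_const
    (Eventually.of_forall fun n => (hF n).aestronglyMeasurable)
    ⟨C, Eventually.of_forall fun n => Eventually.of_forall (hC n)⟩ (Eventually.of_forall hlim)

lemma form_self_eq_integral {f : ℝ → ℂ} (hf : Measurable f) {C : ℝ} (hC : ∀ x, ‖f x‖ ≤ C)
    (φ : H) : E.form f φ φ = ∫ x, f x ∂(E.scalarMeasure φ) := by
  refine bounded_measurable_induction (P := fun f => E.form f φ φ =
    ∫ x, f x ∂(E.scalarMeasure φ)) ?_ ?_ ?_ hf hC
  · intro c Δ hΔ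
    rw [E.form_indicator_const c hΔ, integral_indicator_const c hΔ, measureReal_def,
      scalarMeasure_apply E φ hΔ, inner_proj_self, ENNReal.toReal_ofReal (by positivity),
      Complex.real_smul, mul_comm]
  · intro f g hf hg hfb hgb h1 h2
    rw [E.form_add_fun hf hg hfb hgb, h1, h2]
    obtain ⟨C, hC⟩ := hfb
    obtain ⟨D, hD⟩ := hgb
    exact (integral_add (Integrable.of_bound hf.aestronglyMeasurable C (Eventually.of_forall hC))
      (Integrable.of_bound hg.aestronglyMeasurable D (Eventually.of_forall hD))).symm
  · intro F f C hF hC hlim h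
    refine tendsto_nhds_unique (E.tendsto_form hF hC hlim φ φ) ?_
    simp only [h]
    exact tendsto_integral_of_dominated_convergence (fun _ => C)
      (fun n => (hF n).aestronglyMeasurable) (integrable_const C)
      (fun n => Eventually.of_forall (hC n)) (Eventually.of_forall hlim)

lemma matrixElement_proj_right {Δ : Set ℝ} (hΔ : MeasurableSet Δ) (ψ φ : H) :
    E.matrixElement ψ (E.proj Δ φ) = (E.matrixElement ψ φ).restrict Δ := by
  ext A hA
  rw [VectorMeasure.restrict_apply _ hΔ hA, matrixElement_apply, matrixElement_apply,
    E.proj_apply_proj_inter hA hΔ]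

lemma matrixElement_proj_left {Δ : Set ℝ} (hΔ : MeasurableSet Δ) (ψ φ : H) :
    E.matrixElement (E.proj Δ ψ) φ = (E.matrixElement ψ φ).restrict Δ := by
  ext A hA
  rw [VectorMeasure.restrict_apply _ hΔ hA, matrixElement_apply, matrixElement_apply,
    inner_proj_left, E.proj_apply_proj_inter hΔ hA, Set.inter_comm]

lemma form_proj_right (f : ℝ → ℂ) {Δ : Set ℝ} (hΔ : MeasurableSet Δ) (ψ φ : H) :
    E.form f ψ (E.proj Δ φ) = E.form (Δ.indicator f) ψ φ := by
  rw [form, form, VectorMeasure.integral_indicator hΔ, E.matrixElement_proj_right hΔ]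

lemma form_proj_left (f : ℝ → ℂ) {Δ : Set ℝ} (hΔ : MeasurableSet Δ) (ψ φ : H) :
    E.form f (E.proj Δ ψ) φ = E.form (Δ.indicator f) ψ φ := by
  rw [form, form, VectorMeasure.integral_indicator hΔ, E.matrixElement_proj_left hΔ]

lemma form_integral_right {f g : ℝ → ℂ} (hf : Measurable f) {C : ℝ} (hC : ∀ x, ‖f x‖ ≤ C)
    (hg : Measurable g) {D : ℝ} (hD : ∀ x, ‖g x‖ ≤ D) (ψ φ : H) :
    E.form f ψ (E.integral g hg D hD φ) = E.form (f * g) ψ φ := by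
  refine bounded_measurable_induction (P := fun f => E.form f ψ (E.integral g hg D hD φ) =
    E.form (f * g) ψ φ) ?_ ?_ ?_ hf hC
  · intro c Δ hΔ
    have h : (Δ.indicator fun _ => c) * g = Δ.indicator (fun x => c * g x) := by
      ext x
      by_cases hx : x ∈ Δ <;> simp [hx]
    rw [E.form_indicator_const c hΔ, ← inner_proj_left, inner_integral, h, ← E.form_proj_left _ hΔ]
    have h2 : inner ℂ (E.proj Δ ψ) (E.integral g hg D hD φ) = E.form g (E.proj Δ ψ) φ :=
      inner_integral ..
    refine bounded_measurable_induction (P := fun g => c * E.form g (E.proj Δ ψ) φ =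
      E.form (fun x => c * g x) (E.proj Δ ψ) φ) ?_ ?_ ?_ hg hD
    · intro d Δ' hΔ'
      have h : (fun x => c * Δ'.indicator (fun _ => d) x) = Δ'.indicator (fun _ => c * d) := by
        ext x
        by_cases hx : x ∈ Δ' <;> simp [hx]
      rw [h, E.form_indicator_const _ hΔ', E.form_indicator_const _ hΔ', mul_assoc]
    · intro f g hf hg hfb hgb h1 h2
      rw [E.form_add_fun hf hg hfb hgb, mul_add, h1, h2, ← E.form_add_fun (hf.const_mul c)
        (hg.const_mul c)]
      · congr 1
        ext x
        simp [mul_add]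
      · obtain ⟨C, hC⟩ := hfb
        exact ⟨‖c‖ * C, fun x => by rw [norm_mul]; gcongr; exact hC x⟩
      · obtain ⟨C, hC⟩ := hgb
        exact ⟨‖c‖ * C, fun x => by rw [norm_mul]; gcongr; exact hC x⟩
    · intro F f C hF hC hlim h
      refine tendsto_nhds_unique ((E.tendsto_form hF hC hlim _ _).const_mul c) ?_
      simp only [h]
      exact E.tendsto_form (fun n => (hF n).const_mul c) (C := ‖c‖ * C)
        (fun n x => by rw [norm_mul]; gcongr; exact hC n x) (fun x => (hlim x).const_mul c) _ _
  · intro f g' hf hg' hfb hgb h1 h2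
    rw [E.form_add_fun hf hg' hfb hgb, h1, h2, add_mul, E.form_add_fun (hf.mul hg) (hg'.mul hg)]
    · obtain ⟨C, hC⟩ := hfb
      exact ⟨C * D, fun x => by
        rw [Pi.mul_apply, norm_mul]
        exact mul_le_mul (hC x) (hD x) (norm_nonneg _) ((norm_nonneg _).trans (hC x))⟩
    · obtain ⟨C, hC⟩ := hgb
      exact ⟨C * D, fun x => by
        rw [Pi.mul_apply, norm_mul]
        exact mul_le_mul (hC x) (hD x) (norm_nonneg _) ((norm_nonneg _).trans (hC x))⟩
  · intro F f C hF hC hlim h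
    refine tendsto_nhds_unique (E.tendsto_form hF hC hlim _ _) ?_
    simp only [h]
    exact E.tendsto_form (fun n => (hF n).mul hg) (C := C * D)
      (fun n x => by
        rw [Pi.mul_apply, norm_mul]
        exact mul_le_mul (hC n x) (hD x) (norm_nonneg _) ((norm_nonneg _).trans (hC n x)))
      (fun x => (hlim x).mul_const _) _ _

lemma form_const_mul (c : ℂ) {f : ℝ → ℂ} (hf : Measurable f) {C : ℝ} (hC : ∀ x, ‖f x‖ ≤ C)
    (ψ φ : H) : E.form (fun x => c * f x) ψ φ = c * E.form f ψ φ := by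
  have h : E.form (fun _ => c) ψ (E.integral f hf C hC φ) = c * E.form f ψ φ := by
    have := E.form_indicator_const c MeasurableSet.univ ψ (E.integral f hf C hC φ)
    rwa [Set.indicator_univ, E.proj_univ, one_apply_eq_self, inner_integral] at this
  rw [← h, E.form_integral_right measurable_const (C := ‖c‖) (fun _ => le_rfl)]
  rfl

/-- A uniformly absolutely convergent series of bounded Borel functions can be integrated
term by term. -/
lemma hasSum_form {F : ℕ → ℝ → ℂ} {f : ℝ → ℂ} {b : ℕ → ℝ} (hF : ∀ n, Measurable (F n))
    (hb : ∀ n x, ‖F n x‖ ≤ b n) (hs : Summable b) (hsum : ∀ x, HasSum (fun n => F n x) (f x))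
    (ψ φ : H) : HasSum (fun n => E.form (F n) ψ φ) (E.form f ψ φ) :=
  VectorMeasure.hasSum_integral_of_dominated_convergence (fun n _ => b n)
    (fun n => (hF n).aestronglyMeasurable) (fun n => Eventually.of_forall (hb n))
    (Eventually.of_forall fun _ => hs) (integrable_const _) (Eventually.of_forall hsum)

end PVM

lemma hasSum_inner_exp_smul {H : Type u} [NormedAddCommGroup H] [InnerProductSpace ℂ H]
    [CompleteSpace H] (T : H →L[ℂ] H) (c : ℂ) (ψ φ : H) :
    HasSum (fun k : ℕ => (k.factorial : ℂ)⁻¹ * c ^ k * inner ℂ ψ ((T ^ k) φ))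
      (inner ℂ ψ (NormedSpace.exp (c • T) φ)) := by
  have h := ((NormedSpace.exp_series_hasSum_exp' (𝕂 := ℂ) (c • T)).mapL
    (ContinuousLinearMap.apply ℂ H φ)).mapL (innerSL ℂ ψ)
  refine Eq.mpr (congrArg (fun g => HasSum g _) (funext fun k => ?_)) h
  simp [smul_pow, mul_assoc]

namespace PVM

variable {H : Type u} [NormedAddCommGroup H] [InnerProductSpace ℂ H] [CompleteSpace H]
  (E : PVM H)

lemma integral_proj {f : ℝ → ℂ} (hf : Measurable f) {C : ℝ} (hC : ∀ x, ‖f x‖ ≤ C) {Δ : Set ℝ}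
    (hΔ : MeasurableSet Δ) (ψ φ : H) :
    inner ℂ ψ (E.integral f hf C hC (E.proj Δ φ)) = E.form (Δ.indicator f) ψ φ := by
  rw [inner_integral, E.form_proj_right f hΔ]

lemma proj_integral {f : ℝ → ℂ} (hf : Measurable f) {C : ℝ} (hC : ∀ x, ‖f x‖ ≤ C) {Δ : Set ℝ}
    (hΔ : MeasurableSet Δ) (ψ φ : H) :
    inner ℂ ψ (E.proj Δ (E.integral f hf C hC φ)) = E.form (Δ.indicator f) ψ φ := by
  rw [← inner_proj_left, inner_integral, E.form_proj_left f hΔ]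

lemma norm_integral_apply_le {f : ℝ → ℂ} (hf : Measurable f) {C : ℝ} (hC : ∀ x, ‖f x‖ ≤ C)
    (φ : H) : ‖E.integral f hf C hC φ‖ ≤ 2 * C * ‖φ‖ := by
  set v := E.integral f hf C hC φ with hv
  have h : ‖v‖ * ‖v‖ ≤ 2 * C * ‖φ‖ * ‖v‖ := by
    calc ‖v‖ * ‖v‖ = ‖(inner ℂ v v : ℂ)‖ := by
          rw [inner_self_eq_norm_sq_to_K]; simp [sq]
      _ = ‖E.form f v φ‖ := by rw [← E.inner_integral f hf C hC]
      _ ≤ 2 * C * ‖v‖ * ‖φ‖ := E.norm_form_le hf hC v φ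
      _ = 2 * C * ‖φ‖ * ‖v‖ := by ring
  rcases eq_or_lt_of_le (norm_nonneg v) with h0 | h0
  · rw [← h0]
    have := (norm_nonneg _).trans (hC 0)
    positivity
  · exact le_of_mul_le_mul_right h h0

lemma scalarMeasure_proj {Δ : Set ℝ} (hΔ : MeasurableSet Δ) (φ : H) :
    E.scalarMeasure (E.proj Δ φ) = (E.scalarMeasure φ).restrict Δ := by
  ext s hs
  rw [Measure.restrict_apply hs, scalarMeasure_apply E _ hs, scalarMeasure_apply E _ (hs.inter hΔ),
    E.proj_apply_proj_inter hs hΔ]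

/-- The spectral projection of the interval `[-n, n]`. -/
noncomputable def cutProj (n : ℕ) : H →L[ℂ] H := E.proj (Set.Icc (-n : ℝ) n)

/-- The identity function, cut off outside `[-n, n]`. -/
noncomputable def cutFun (n : ℕ) : ℝ → ℂ := (Set.Icc (-n : ℝ) n).indicator fun x => (x : ℂ)

lemma measurable_cutFun (n : ℕ) : Measurable (cutFun n) :=
  Complex.measurable_ofReal.indicator measurableSet_Icc

lemma norm_cutFun_le (n : ℕ) (x : ℝ) : ‖cutFun n x‖ ≤ n := by
  by_cases hx : x ∈ Set.Icc (-n : ℝ) n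
  · rw [cutFun, Set.indicator_of_mem hx, Complex.norm_real, Real.norm_eq_abs, abs_le]
    exact hx
  · rw [cutFun, Set.indicator_of_notMem hx]
    simp

/-- The bounded operator `∫_{[-n, n]} x dE(x)`. -/
noncomputable def cutOp (n : ℕ) : H →L[ℂ] H :=
  E.integral (cutFun n) (measurable_cutFun n) n (norm_cutFun_le n)

lemma Icc_neg_nat_mono {n m : ℕ} (h : n ≤ m) :
    Set.Icc (-n : ℝ) n ⊆ Set.Icc (-m : ℝ) m := by
  have : (n : ℝ) ≤ m := by exact_mod_cast h
  exact Set.Icc_subset_Icc (by linarith) this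

lemma cutProj_cutProj_of_le {n m : ℕ} (h : n ≤ m) (φ : H) :
    E.cutProj m (E.cutProj n φ) = E.cutProj n φ := by
  rw [cutProj, cutProj, E.proj_apply_proj_inter measurableSet_Icc measurableSet_Icc,
    Set.inter_eq_right.2 (Icc_neg_nat_mono h)]

lemma inner_cutProj_left (n : ℕ) (ψ φ : H) :
    inner ℂ (E.cutProj n ψ) φ = inner ℂ ψ (E.cutProj n φ) := E.inner_proj_left _ ψ φ

lemma cutOp_cutProj_of_le {n m : ℕ} (h : n ≤ m) (φ : H) :
    E.cutOp m (E.cutProj n φ) = E.cutOp n φ := by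
  refine ext_inner_left ℂ fun ψ => ?_
  rw [cutOp, cutOp, cutProj, E.integral_proj _ _ measurableSet_Icc, inner_integral, cutFun, cutFun,
    Set.indicator_indicator, Set.inter_eq_left.2 (Icc_neg_nat_mono h)]

lemma cutOp_cutProj (n : ℕ) (φ : H) : E.cutOp n (E.cutProj n φ) = E.cutOp n φ :=
  E.cutOp_cutProj_of_le le_rfl φ

lemma cutProj_cutOp (n : ℕ) (φ : H) : E.cutProj n (E.cutOp n φ) = E.cutOp n φ := by
  refine ext_inner_left ℂ fun ψ => ?_
  rw [cutOp, cutProj, E.proj_integral _ _ measurableSet_Icc, inner_integral, cutFun,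
    Set.indicator_indicator, Set.inter_self]

lemma isSelfAdjoint_cutOp (n : ℕ) : IsSelfAdjoint (E.cutOp n) := by
  rw [ContinuousLinearMap.isSelfAdjoint_iff_isSymmetric,
    LinearMap.isSymmetric_iff_inner_map_self_real]
  intro φ
  have h : inner ℂ φ (E.cutOp n φ) =
      ((∫ x, (Set.Icc (-n : ℝ) n).indicator id x ∂(E.scalarMeasure φ) : ℝ) : ℂ) := by
    rw [cutOp, inner_integral, E.form_self_eq_integral (measurable_cutFun n) (norm_cutFun_le n),
      ← integral_complex_ofReal]
    congr 1
    ext x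
    by_cases hx : x ∈ Set.Icc (-n : ℝ) n <;> simp [cutFun, hx]
  rw [inner_conj_symm]
  change _ = inner ℂ (E.cutOp n φ) φ
  rw [← inner_conj_symm (E.cutOp n φ) φ]
  change inner ℂ φ (E.cutOp n φ) = _
  rw [h, Complex.conj_ofReal]

lemma norm_sub_proj_sq (Δ : Set ℝ) (φ : H) :
    ‖φ - E.proj Δ φ‖ ^ 2 = ‖φ‖ ^ 2 - ‖E.proj Δ φ‖ ^ 2 := by
  have h : inner ℂ (E.proj Δ φ) (φ - E.proj Δ φ) = 0 := by
    rw [inner_proj_left, map_sub, proj_apply_proj, sub_self, inner_zero_right]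
  have := norm_add_sq_eq_norm_sq_add_norm_sq_of_inner_eq_zero _ _ h
  rw [add_sub_cancel] at this
  nlinarith

lemma tendsto_cutProj (φ : H) : Tendsto (fun n => E.cutProj n φ) atTop (𝓝 φ) := by
  have hmono : Monotone fun n : ℕ => Set.Icc (-n : ℝ) n := fun n m h => Icc_neg_nat_mono h
  have hU : ⋃ n : ℕ, Set.Icc (-n : ℝ) n = Set.univ := by
    refine Set.eq_univ_of_forall fun x => ?_
    obtain ⟨n, hn⟩ := exists_nat_ge |x|
    exact Set.mem_iUnion.2 ⟨n, abs_le.1 hn⟩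
  have h := tendsto_measure_iUnion_atTop (μ := E.scalarMeasure φ) hmono
  rw [hU, scalarMeasure_univ] at h
  have h2 := (ENNReal.tendsto_toReal ENNReal.ofReal_ne_top).comp h
  simp only [Function.comp_def, scalarMeasure_apply E φ measurableSet_Icc] at h2
  rw [ENNReal.toReal_ofReal (by positivity)] at h2
  have h3 : Tendsto (fun n => ‖φ - E.cutProj n φ‖ ^ 2) atTop (𝓝 0) := by
    have h4 := h2.const_sub (‖φ‖ ^ 2)
    rw [sub_self] at h4
    refine h4.congr fun n => ?_
    rw [cutProj, norm_sub_proj_sq, ENNReal.toReal_ofReal (by positivity)]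
  rw [tendsto_iff_norm_sub_tendsto_zero]
  have h5 := h3.sqrt
  rw [Real.sqrt_zero] at h5
  refine h5.congr fun n => ?_
  rw [Real.sqrt_sq (norm_nonneg _), norm_sub_rev]

lemma measurable_indicator_pow (n k : ℕ) :
    Measurable ((Set.Icc (-n : ℝ) n).indicator fun x => (x : ℂ) ^ k) :=
  (Complex.measurable_ofReal.pow_const k).indicator measurableSet_Icc

lemma norm_indicator_pow_le (n k : ℕ) (x : ℝ) :
    ‖(Set.Icc (-n : ℝ) n).indicator (fun x => (x : ℂ) ^ k) x‖ ≤ (n : ℝ) ^ k := by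
  by_cases hx : x ∈ Set.Icc (-n : ℝ) n
  · rw [Set.indicator_of_mem hx, norm_pow, Complex.norm_real, Real.norm_eq_abs]
    gcongr
    exact abs_le.2 hx
  · rw [Set.indicator_of_notMem hx, norm_zero]
    positivity

lemma cutOp_pow_cutProj (n k : ℕ) (φ : H) : (E.cutOp n ^ k) (E.cutProj n φ) =
    E.integral _ (measurable_indicator_pow n k) _ (norm_indicator_pow_le n k) φ := by
  induction k with
  | zero =>
    refine ext_inner_left ℂ fun ψ => ?_
    simp only [pow_zero, one_apply_eq_self]
    rw [inner_integral, E.form_indicator_const _ measurableSet_Icc, one_mul, cutProj]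
  | succ k ih =>
    refine ext_inner_left ℂ fun ψ => ?_
    rw [pow_succ', mul_apply_eq_comp, ih, cutOp, inner_integral,
      E.form_integral_right (measurable_cutFun n) (norm_cutFun_le n), inner_integral]
    congr 1
    ext x
    by_cases hx : x ∈ Set.Icc (-n : ℝ) n <;> simp [cutFun, hx, pow_succ']

/-- Functional calculus of an entire function on the range of a spectral projection. -/
lemma hasSum_form_cutProj {c : ℕ → ℂ} {f : ℝ → ℂ} (n : ℕ)
    (hc : Summable fun k => ‖c k‖ * (n : ℝ) ^ k)
    (hf : ∀ x : ℝ, HasSum (fun k => c k * (x : ℂ) ^ k) (f x)) (ψ φ : H) :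
    HasSum (fun k => c k * inner ℂ ψ ((E.cutOp n ^ k) (E.cutProj n φ)))
      (E.form f ψ (E.cutProj n φ)) := by
  have h := E.hasSum_form (F := fun k x => c k * (Set.Icc (-n : ℝ) n).indicator
    (fun x => (x : ℂ) ^ k) x) (f := (Set.Icc (-n : ℝ) n).indicator f)
    (b := fun k => ‖c k‖ * (n : ℝ) ^ k) (fun k => (measurable_indicator_pow n k).const_mul _)
    (fun k x => by rw [norm_mul]; gcongr; exact norm_indicator_pow_le n k x) hc (fun x => by
      by_cases hx : x ∈ Set.Icc (-n : ℝ) n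
      · simpa [hx] using! hf x
      · simp [hx]) ψ φ
  rw [cutProj, E.form_proj_right f measurableSet_Icc]
  convert h using 2 with k
  rw [E.form_const_mul _ (measurable_indicator_pow n k) (norm_indicator_pow_le n k), ← cutProj,
    cutOp_pow_cutProj, inner_integral]

lemma summable_exp_coeff (z : ℂ) (r : ℝ) :
    Summable fun k : ℕ => ‖(k.factorial : ℂ)⁻¹ * z ^ k‖ * r ^ k := by
  refine (Real.summable_pow_div_factorial (‖z‖ * r)).congr fun k => ?_
  rw [norm_mul, norm_inv, norm_pow, Complex.norm_natCast, mul_pow]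
  ring

lemma integral_exp_cutProj (z : ℂ) (hf : Measurable fun x : ℝ => Complex.exp (z * x)) (C : ℝ)
    (hC : ∀ x : ℝ, ‖Complex.exp (z * x)‖ ≤ C) (n : ℕ) (φ : H) :
    E.integral (fun x : ℝ => Complex.exp (z * x)) hf C hC (E.cutProj n φ) =
      NormedSpace.exp (z • E.cutOp n) (E.cutProj n φ) := by
  refine ext_inner_left ℂ fun ψ => ?_
  rw [inner_integral]
  refine (E.hasSum_form_cutProj n (summable_exp_coeff z n) (fun x => ?_) ψ φ).unique
    (hasSum_inner_exp_smul (E.cutOp n) z ψ (E.cutProj n φ))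
  have h := NormedSpace.exp_series_hasSum_exp' (𝕂 := ℂ) (z * x)
  rw [← Complex.exp_eq_exp_ℂ] at h
  refine Eq.mpr (congrArg (fun g => HasSum g _) (funext fun k => ?_)) h
  rw [smul_eq_mul, mul_pow, mul_assoc]

end PVM

lemma IsSelfAdjoint.inner_apply_eq {H : Type u} [NormedAddCommGroup H] [InnerProductSpace ℂ H]
    [CompleteSpace H] {A : H →ₗ.[ℂ] H} (hA : IsSelfAdjoint A) (φ ψ : A.domain) :
    inner ℂ (A φ) (ψ : H) = inner ℂ (φ : H) (A ψ) := by
  have h := LinearPMap.adjoint_isFormalAdjoint hA.dense_domain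
  rw [LinearPMap.isSelfAdjoint_def.1 hA] at h
  exact h φ ψ

namespace PVM.IsSpectralMeasureOf

variable {H : Type u} [NormedAddCommGroup H] [InnerProductSpace ℂ H] [CompleteSpace H]
  {E : PVM H} {A : H →ₗ.[ℂ] H}

lemma cutProj_mem (hE : E.IsSpectralMeasureOf A) (n : ℕ) (φ : H) :
    E.cutProj n φ ∈ A.domain := by
  rw [hE.1, cutProj, E.scalarMeasure_proj measurableSet_Icc]
  exact (continuous_pow 2).integrableOn_Icc

lemma inner_apply_cutProj (hE : E.IsSpectralMeasureOf A) (n : ℕ) (φ : H) :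
    inner ℂ (E.cutProj n φ) (A ⟨E.cutProj n φ, hE.cutProj_mem n φ⟩) =
      inner ℂ φ (E.cutOp n φ) := by
  rw [hE.2 ⟨E.cutProj n φ, hE.cutProj_mem n φ⟩, cutOp, inner_integral,
    E.form_self_eq_integral (measurable_cutFun n) (norm_cutFun_le n), ← integral_complex_ofReal]
  simp only [cutProj, cutFun]
  rw [E.scalarMeasure_proj measurableSet_Icc, integral_indicator measurableSet_Icc]

lemma apply_cutProj (hE : E.IsSpectralMeasureOf A) (n : ℕ) (φ : H) :
    A ⟨E.cutProj n φ, hE.cutProj_mem n φ⟩ = E.cutOp n φ := by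
  have key : ∀ (m : ℕ) (φ : H), E.cutProj m (A ⟨E.cutProj m φ, hE.cutProj_mem m φ⟩) =
      E.cutOp m φ := by
    intro m φ
    let B : H →ₗ[ℂ] H := A.toFun ∘ₗ (E.cutProj m).toLinearMap.codRestrict A.domain
      (hE.cutProj_mem m)
    have h0 : (E.cutProj m).toLinearMap ∘ₗ B - (E.cutOp m).toLinearMap = 0 := by
      rw [← inner_map_self_eq_zero]
      intro ψ
      have h1 : inner ℂ ψ (E.cutProj m (B ψ)) = inner ℂ ψ (E.cutOp m ψ) :=
        (E.inner_cutProj_left m ψ _).symm.trans (hE.inner_apply_cutProj m ψ)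
      rw [LinearMap.sub_apply, inner_sub_left, sub_eq_zero]
      simpa only [inner_conj_symm] using! congrArg (starRingEnd ℂ) h1
    exact sub_eq_zero.1 (LinearMap.congr_fun h0 φ)
  refine tendsto_nhds_unique (E.tendsto_cutProj _) (tendsto_const_nhds.congr' ?_)
  filter_upwards [eventually_ge_atTop n] with m hm
  have h := key m (E.cutProj n φ)
  simp only [E.cutProj_cutProj_of_le hm, E.cutOp_cutProj_of_le hm] at h
  exact h.symm

lemma cutProj_apply (hE : E.IsSpectralMeasureOf A) (hA : IsSelfAdjoint A) (n : ℕ)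
    (φ : A.domain) : E.cutProj n (A φ) = E.cutOp n φ := by
  refine ext_inner_left ℂ fun ψ => ?_
  rw [← E.inner_cutProj_left]
  have h := hA.inner_apply_eq ⟨E.cutProj n ψ, hE.cutProj_mem n ψ⟩ φ
  rw [hE.apply_cutProj] at h
  rw [← h]
  exact (ContinuousLinearMap.isSelfAdjoint_iff_isSymmetric.1 (E.isSelfAdjoint_cutOp n)) ψ φ

end PVM.IsSpectralMeasureOf

section Spectrum

variable {H : Type u} [NormedAddCommGroup H] [InnerProductSpace ℂ H] [CompleteSpace H]

lemma isClosed_realSpectrum (A : H →ₗ.[ℂ] H) : IsClosed (realSpectrum A) := by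
  rw [← isOpen_compl_iff, Metric.isOpen_iff]
  intro y hy
  obtain ⟨R, hR1, hR2⟩ := not_not.1 hy
  refine ⟨(‖R‖ + 1)⁻¹, by positivity, fun z hz => not_not.2 ?_⟩
  have hlt : ‖((z - y : ℝ) : ℂ) • R‖ < 1 := by
    rw [norm_smul, Complex.norm_real, ← dist_eq_norm]
    calc dist z y * ‖R‖ ≤ (‖R‖ + 1)⁻¹ * ‖R‖ := by
          gcongr
          exact (Metric.mem_ball.1 hz).le
      _ < (‖R‖ + 1)⁻¹ * (‖R‖ + 1) := by gcongr; linarith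
      _ = 1 := inv_mul_cancel₀ (by positivity)
  obtain ⟨Q, hQ⟩ := isUnit_one_sub_of_norm_lt_one hlt
  set W : H →L[ℂ] H := (↑Q⁻¹ : H →L[ℂ] H) with hW
  have h1 : ∀ φ, W (φ - ((z - y : ℝ) : ℂ) • R φ) = φ := fun φ => by
    have := congrArg (fun T : H →L[ℂ] H => T φ) Q.inv_mul
    rw [hQ] at this
    exact this
  have h2 : ∀ φ, W φ - ((z - y : ℝ) : ℂ) • R (W φ) = φ := fun φ => by
    have := congrArg (fun T : H →L[ℂ] H => T φ) Q.mul_inv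
    rw [hQ] at this
    exact this
  refine ⟨R * W, fun φ => ?_, fun φ => ?_⟩
  · have h3 : A φ - (z : ℂ) • (φ : H) = (A φ - (y : ℂ) • (φ : H)) -
        ((z - y : ℝ) : ℂ) • R (A φ - (y : ℂ) • (φ : H)) := by
      rw [hR1]
      push_cast
      module
    rw [mul_apply_eq_comp, h3, h1, hR1]
  · obtain ⟨h, h'⟩ := hR2 (W φ)
    refine ⟨h, ?_⟩
    change A ⟨R (W φ), h⟩ - (z : ℂ) • R (W φ) = φ
    rw [sub_eq_iff_eq_add] at h'
    rw [h']
    refine Eq.trans ?_ (h2 φ)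
    push_cast
    module

lemma PVM.IsSpectralMeasureOf.scalarMeasure_compl_realSpectrum {E : PVM H} {A : H →ₗ.[ℂ] H}
    (hE : E.IsSpectralMeasureOf A) (φ : H) : E.scalarMeasure φ (realSpectrum A)ᶜ = 0 := by
  refine measure_null_of_locally_null _ fun y hy => ?_
  obtain ⟨R, hR, -⟩ := not_not.1 hy
  set ε : ℝ := (2 * ‖R‖ + 1)⁻¹ with hε
  have hε0 : 0 < ε := by positivity
  set Δ := Set.Ioo (y - ε) (y + ε) with hΔ
  have hΔm : MeasurableSet Δ := measurableSet_Ioo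
  refine ⟨Δ, mem_nhdsWithin_of_mem_nhds (Ioo_mem_nhds (by linarith) (by linarith)), ?_⟩
  obtain ⟨n, hn⟩ := exists_nat_ge (|y| + ε)
  have hsub : Δ ⊆ Set.Icc (-n : ℝ) n := fun x hx => by
    have h1 := neg_abs_le y
    have h2 := le_abs_self y
    constructor <;> linarith [hx.1, hx.2]
  have hcut : E.cutProj n (E.proj Δ φ) = E.proj Δ φ := by
    rw [cutProj, E.proj_apply_proj_inter measurableSet_Icc hΔm, Set.inter_eq_right.2 hsub]
  set χ := E.proj Δ φ with hχ
  have hmem : χ ∈ A.domain := hcut ▸ hE.cutProj_mem n χ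
  have hA : A ⟨χ, hmem⟩ = E.cutOp n χ := by
    rw [← hE.apply_cutProj n χ]
    congr 2
    exact hcut.symm
  set g : ℝ → ℂ := Δ.indicator fun x => (x : ℂ) - y with hg
  have hgm : Measurable g := (Complex.measurable_ofReal.sub_const _).indicator hΔm
  have hgb : ∀ x, ‖g x‖ ≤ ε := fun x => by
    by_cases hx : x ∈ Δ
    · rw [hg, Set.indicator_of_mem hx, ← Complex.ofReal_sub, Complex.norm_real, Real.norm_eq_abs,
        abs_le]
      constructor <;> linarith [hx.1, hx.2]
    · rw [hg, Set.indicator_of_notMem hx, norm_zero]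
      exact hε0.le
  have hsubeq : E.cutOp n χ - (y : ℂ) • χ = E.integral g hgm ε hgb χ := by
    refine ext_inner_left ℂ fun ψ => ?_
    have h1 : Δ.indicator (cutFun n) = g + Δ.indicator fun _ => (y : ℂ) := by
      ext x
      by_cases hx : x ∈ Δ
      · simp [hg, hx, cutFun, Set.indicator_of_mem (hsub hx)]
      · simp [hg, hx]
    have h2 : Δ.indicator g = g := by rw [hg, Set.indicator_indicator, Set.inter_self]
    rw [inner_sub_right, inner_smul_right, cutOp, hχ, E.integral_proj _ _ hΔm,
      E.integral_proj _ _ hΔm, h1, h2, E.form_add_fun hgm (measurable_const.indicator hΔm) ⟨ε, hgb⟩,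
      E.form_indicator_const _ hΔm, add_sub_cancel_right]
    refine ⟨‖(y : ℂ)‖, fun x => ?_⟩
    exact norm_indicator_le_norm_self (fun _ => (y : ℂ)) x
  have hle : ‖χ‖ ≤ ‖R‖ * (2 * ε * ‖χ‖) := by
    have h := hR ⟨χ, hmem⟩
    rw [hA] at h
    change R (E.cutOp n χ - (y : ℂ) • χ) = χ at h
    rw [hsubeq] at h
    calc ‖χ‖ = ‖R (E.integral g hgm ε hgb χ)‖ := by rw [h]
      _ ≤ ‖R‖ * ‖E.integral g hgm ε hgb χ‖ := R.le_opNorm _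
      _ ≤ ‖R‖ * (2 * ε * ‖χ‖) := by
        gcongr
        exact E.norm_integral_apply_le hgm hgb χ
  have hlt : ‖R‖ * (2 * ε) < 1 := by
    calc ‖R‖ * (2 * ε) = (2 * ‖R‖) * ε := by ring
      _ < (2 * ‖R‖ + 1) * ε := by gcongr; linarith
      _ = 1 := mul_inv_cancel₀ (by positivity)
  have h0 : ‖χ‖ = 0 := by nlinarith [norm_nonneg χ]
  rw [scalarMeasure_apply E φ hΔm, h0]
  simp

end Spectrum

section Resolvent

variable {H : Type u} [NormedAddCommGroup H] [InnerProductSpace ℂ H] [CompleteSpace H]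

lemma IsSelfAdjoint.norm_apply_add_smul_sq {A : H →ₗ.[ℂ] H} (hA : IsSelfAdjoint A) {c : ℂ}
    (hre : c.re = 0) (hc : ‖c‖ = 1) (φ : A.domain) :
    ‖A φ + c • (φ : H)‖ ^ 2 = ‖A φ‖ ^ 2 + ‖(φ : H)‖ ^ 2 := by
  have him : (inner ℂ (A φ) (φ : H) : ℂ).im = 0 := by
    have h := inner_conj_symm (𝕜 := ℂ) (A φ) (φ : H)
    rw [← hA.inner_apply_eq φ φ, Complex.conj_eq_iff_im] at h
    exact h
  have h0 : RCLike.re (inner ℂ (A φ) (c • (φ : H)) : ℂ) = 0 := by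
    rw [inner_smul_right]
    simp [hre, him]
  rw [norm_add_sq (𝕜 := ℂ), h0, norm_smul, hc]
  ring

lemma IsSelfAdjoint.exists_resolvent {A : H →ₗ.[ℂ] H} (hA : IsSelfAdjoint A) {c : ℂ}
    (hre : c.re = 0) (hc : ‖c‖ = 1) : ∃ R : H →L[ℂ] H,
      (∀ φ : A.domain, R (A φ + c • (φ : H)) = φ) ∧
      ∀ φ : H, ∃ h : R φ ∈ A.domain, A ⟨R φ, h⟩ + c • R φ = φ := by
  have hcl : IsClosed (A.graph : Set (H × H)) := hA.isClosed
  have : CompleteSpace A.graph := hcl.completeSpace_coe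
  let G : A.graph →L[ℂ] H := (ContinuousLinearMap.snd ℂ H H + c • ContinuousLinearMap.fst ℂ H H) ∘L
    A.graph.subtypeL
  have hG : ∀ p : A.graph, G p = p.1.2 + c • p.1.1 := fun p => rfl
  have hanti : AntilipschitzWith 1 G := by
    refine AddMonoidHomClass.antilipschitz_of_bound G fun p => ?_
    obtain ⟨φ, h1, h2⟩ := (LinearPMap.mem_graph_iff A).1 p.2
    have h := hA.norm_apply_add_smul_sq hre hc φ
    rw [h1, h2, ← hG] at h
    rw [NNReal.coe_one, one_mul, Submodule.coe_norm, Prod.norm_def, max_le_iff]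
    exact ⟨abs_le_of_sq_le_sq' (by nlinarith [sq_nonneg ‖p.1.2‖]) (norm_nonneg _) |>.2,
      abs_le_of_sq_le_sq' (by nlinarith [sq_nonneg ‖p.1.1‖]) (norm_nonneg _) |>.2⟩
  have hrc : IsClosed (Set.range G) := hanti.isClosed_range G.uniformContinuous
  have hperp : (LinearMap.range G.toLinearMap)ᗮ = ⊥ := by
    rw [Submodule.eq_bot_iff]
    intro η hη
    rw [Submodule.mem_orthogonal] at hη
    have h1 : ∀ φ : A.domain, inner ℂ (-(starRingEnd ℂ c) • η) (φ : H) = inner ℂ η (A φ) := by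
      intro φ
      have h2 := hη (A φ + c • (φ : H)) ⟨⟨(φ, A φ), A.mem_graph φ⟩, rfl⟩
      rw [inner_add_left, inner_smul_left] at h2
      have h3 := congrArg (starRingEnd ℂ) h2
      rw [map_add, map_mul, inner_conj_symm, inner_conj_symm, map_zero, Complex.conj_conj] at h3
      rw [inner_smul_left, map_neg, Complex.conj_conj]
      linear_combination -h3
    have hmem : η ∈ A.domain := by
      have := LinearPMap.mem_adjoint_domain_of_exists (T := A) η ⟨_, h1⟩
      rwa [LinearPMap.isSelfAdjoint_def.1 hA] at this
    have hAη : A ⟨η, hmem⟩ = -(starRingEnd ℂ c) • η := by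
      refine hA.dense_domain.eq_of_inner_left ℂ fun φ hφ => ?_
      rw [h1 ⟨φ, hφ⟩]
      exact hA.inner_apply_eq ⟨η, hmem⟩ ⟨φ, hφ⟩
    have h4 := hA.norm_apply_add_smul_sq (c := starRingEnd ℂ c) (by simpa using hre)
      (by simpa using hc) ⟨η, hmem⟩
    rw [hAη] at h4
    simp only [neg_smul, neg_add_cancel, norm_zero, norm_neg, norm_smul, RCLike.norm_conj, hc]
      at h4
    exact norm_eq_zero.1 (by nlinarith [norm_nonneg η])
  have hrange : LinearMap.range G.toLinearMap = ⊤ := by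
    rw [← Submodule.topologicalClosure_eq_top_iff] at hperp
    rw [← hperp]
    exact (IsClosed.submodule_topologicalClosure_eq hrc).symm
  have hker : LinearMap.ker G.toLinearMap = ⊥ := LinearMap.ker_eq_bot.2 hanti.injective
  let e := ContinuousLinearEquiv.ofBijective G hker hrange
  refine ⟨ContinuousLinearMap.fst ℂ H H ∘L A.graph.subtypeL ∘L e.symm.toContinuousLinearMap,
    fun φ => ?_, fun φ => ?_⟩
  · have h : e.symm (A φ + c • (φ : H)) = ⟨(φ, A φ), A.mem_graph φ⟩ := by
      rw [ContinuousLinearEquiv.symm_apply_eq]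
      rfl
    change (e.symm (A φ + c • (φ : H))).1.1 = φ
    rw [h]
  · obtain ⟨χ, h1, h2⟩ := (LinearPMap.mem_graph_iff A).1 (e.symm φ).2
    have hmem : (e.symm φ).1.1 ∈ A.domain := h1 ▸ χ.2
    refine ⟨hmem, ?_⟩
    have h3 : A ⟨(e.symm φ).1.1, hmem⟩ = (e.symm φ).1.2 := by
      rw [← h2]
      congr 1
      exact Subtype.ext h1.symm
    change A ⟨(e.symm φ).1.1, hmem⟩ + c • (e.symm φ).1.1 = φ
    rw [h3, ← hG]
    exact e.apply_symm_apply φ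

/-- The resolvent `(A + i)⁻¹` of a self-adjoint operator, with the algebraic identities that its
adjoint `(A - i)⁻¹` satisfies. -/
lemma IsSelfAdjoint.exists_normal_resolvent {A : H →ₗ.[ℂ] H} (hA : IsSelfAdjoint A) :
    ∃ R : H →L[ℂ] H, (∀ φ : A.domain, R (A φ + Complex.I • (φ : H)) = φ) ∧
      (∀ φ : H, ∃ h : R φ ∈ A.domain, A ⟨R φ, h⟩ + Complex.I • R φ = φ) ∧
      star R - R = (2 * Complex.I) • (star R * R) ∧ star R * R = R * star R := by
  obtain ⟨R, hR1, hR2⟩ := hA.exists_resolvent (c := Complex.I) (by simp) (by simp)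
  obtain ⟨S, hS1, hS2⟩ := hA.exists_resolvent (c := -Complex.I) (by simp) (by simp)
  have hadj : star R = S := by
    refine (ContinuousLinearMap.eq_adjoint_iff S R).2 (fun φ ψ => ?_) |>.symm
    obtain ⟨h1, h1'⟩ := hS2 φ
    obtain ⟨h2, h2'⟩ := hR2 ψ
    conv_lhs => rw [← h2']
    conv_rhs => rw [← h1']
    rw [inner_add_right, inner_add_left, inner_smul_right, inner_smul_left, map_neg,
      Complex.conj_I, neg_neg]
    congr 1
    exact (hA.inner_apply_eq ⟨S φ, h1⟩ ⟨R ψ, h2⟩).symm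
  have e1 : S - R = (2 * Complex.I) • (R * S) := by
    ext φ
    obtain ⟨h, h'⟩ := hS2 φ
    have h3 := hR1 ⟨S φ, h⟩
    have h4 : A ⟨S φ, h⟩ + Complex.I • S φ = φ + (2 * Complex.I) • S φ := by
      rw [eq_sub_of_add_eq h']
      module
    change R (A ⟨S φ, h⟩ + Complex.I • S φ) = S φ at h3
    rw [h4, map_add, map_smul] at h3
    change S φ - R φ = (2 * Complex.I) • R (S φ)
    exact sub_eq_iff_eq_add'.2 h3.symm
  have e2 : S - R = (2 * Complex.I) • (S * R) := by
    ext φ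
    obtain ⟨h, h'⟩ := hR2 φ
    have h3 := hS1 ⟨R φ, h⟩
    have h4 : A ⟨R φ, h⟩ + -Complex.I • R φ = φ - (2 * Complex.I) • R φ := by
      rw [eq_sub_of_add_eq h']
      module
    change S (A ⟨R φ, h⟩ + -Complex.I • R φ) = R φ at h3
    rw [h4, map_sub, map_smul] at h3
    change S φ - R φ = (2 * Complex.I) • S (R φ)
    conv_lhs => rw [← h3]
    abel
  refine ⟨R, hR1, hR2, hadj ▸ e2, ?_⟩
  rw [hadj]
  have h : (2 * Complex.I) ≠ 0 := by simp
  exact smul_right_injective _ h (e2.symm.trans e1)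

end Resolvent

lemma inner_self_eq_ofReal_norm_sq {H : Type u} [NormedAddCommGroup H] [InnerProductSpace ℂ H]
    (φ : H) : inner ℂ φ φ = ((‖φ‖ ^ 2 : ℝ) : ℂ) := by
  rw [inner_self_eq_norm_sq_to_K]
  simp

namespace StarAlgHom

open scoped CompactlySupported

variable {Ω : Type v} [MetricSpace Ω]
  {H : Type u} [NormedAddCommGroup H] [InnerProductSpace ℂ H] [CompleteSpace H]
  (Φ : C(Ω, ℂ) →⋆ₐ[ℂ] (H →L[ℂ] H))

/-- A real continuous function, regarded as a complex one. -/
def ofRealC (f : C(Ω, ℝ)) : C(Ω, ℂ) := ⟨fun x => (f x : ℂ), by fun_prop⟩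

lemma norm_apply_sq (f : C(Ω, ℂ)) (φ : H) :
    ((‖Φ f φ‖ ^ 2 : ℝ) : ℂ) = inner ℂ φ (Φ (star f * f) φ) := by
  rw [map_mul, map_star, ContinuousLinearMap.star_eq_adjoint, mul_apply_eq_comp,
    ContinuousLinearMap.adjoint_inner_right, inner_self_eq_ofReal_norm_sq]

lemma ofRealC_add (f g : C(Ω, ℝ)) : ofRealC (f + g) = ofRealC f + ofRealC g := by
  ext x; simp [ofRealC]

lemma ofRealC_smul (c : ℝ) (f : C(Ω, ℝ)) : ofRealC (c • f) = (c : ℂ) • ofRealC f := by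
  ext x; simp [ofRealC]

/-- The linear map `f ↦ Φ(f) φ`. -/
noncomputable def orbit (φ : H) : C(Ω, ℂ) →ₗ[ℂ] H :=
  (ContinuousLinearMap.apply ℂ H φ).toLinearMap ∘ₗ Φ.toLinearMap

lemma orbit_apply (f : C(Ω, ℂ)) (φ : H) : Φ.orbit φ f = Φ f φ := rfl

lemma memLp_add_measure {Ω : Type v} [MeasurableSpace Ω] {μ ν : Measure Ω} {g : Ω → ℂ}
    (h1 : MemLp g 2 μ) (h2 : MemLp g 2 ν) : MemLp g 2 (μ + ν) := by
  refine ⟨h1.1.add_measure h2.1, ?_⟩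
  have a1 := (memLp_two_iff_integrable_sq_norm h1.1).1 h1
  have a2 := (memLp_two_iff_integrable_sq_norm h2.1).1 h2
  exact ((memLp_two_iff_integrable_sq_norm (h1.1.add_measure h2.1)).2 (a1.add_measure a2)).2

lemma tendsto_eLpNorm_of_le {Ω : Type v} [MeasurableSpace Ω] {μ ν : Measure Ω} (h : μ ≤ ν)
    {g : Ω → ℂ} {f : ℕ → Ω → ℂ} (hf : Tendsto (fun n => eLpNorm (g - f n) 2 ν) atTop (𝓝 0)) :
    Tendsto (fun n => eLpNorm (g - f n) 2 μ) atTop (𝓝 0) :=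
  tendsto_of_tendsto_of_tendsto_of_le_of_le tendsto_const_nhds hf (fun _ => zero_le)
    fun _ => eLpNorm_mono_measure _ h

lemma inner_ofRealC_nonneg {f : C(Ω, ℝ)} (hf : ∀ x, 0 ≤ f x) (φ : H) :
    0 ≤ (inner ℂ φ (Φ (ofRealC f) φ) : ℂ).re := by
  have h : ofRealC f = star (ofRealC ⟨fun x => √(f x), by fun_prop⟩) *
      ofRealC ⟨fun x => √(f x), by fun_prop⟩ := by
    ext x
    simp [ofRealC, ← Complex.ofReal_mul, Real.mul_self_sqrt (hf x)]
  rw [h, ← norm_apply_sq, Complex.ofReal_re]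
  positivity

variable [CompactSpace Ω] [MeasurableSpace Ω] [BorelSpace Ω]

/-- The positive functional `f ↦ ⟨φ, Φ(f) φ⟩`. -/
noncomputable def functional (φ : H) : C_c(Ω, ℝ) →ₚ[ℝ] ℝ :=
  PositiveLinearMap.mk₀
    { toFun := fun f => (inner ℂ φ (Φ (ofRealC f.toContinuousMap) φ) : ℂ).re
      map_add' := fun f g => by
        have h : (f + g).toContinuousMap = f.toContinuousMap + g.toContinuousMap := rfl
        rw [h, ofRealC_add, map_add, add_apply, inner_add_right, Complex.add_re]
      map_smul' := fun c f => by
        have h : (c • f).toContinuousMap = c • f.toContinuousMap := rfl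
        rw [h, ofRealC_smul, map_smul, smul_apply, inner_smul_right, Complex.re_ofReal_mul]
        rfl }
    fun f hf => Φ.inner_ofRealC_nonneg (fun x => hf x) φ

/-- The spectral measure of `φ` on the compact space `Ω`. -/
noncomputable def measure (φ : H) : Measure Ω := RealRMK.rieszMeasure (Φ.functional φ)

instance (φ : H) : IsFiniteMeasure (Φ.measure φ) := by
  unfold measure; infer_instance

lemma integral_ofRealC_measure (f : C(Ω, ℝ)) (φ : H) :
    ((∫ x, f x ∂(Φ.measure φ) : ℝ) : ℂ) = inner ℂ φ (Φ (ofRealC f) φ) := by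
  have h := RealRMK.integral_rieszMeasure (Φ.functional φ)
    (CompactlySupportedContinuousMap.continuousMapEquiv f)
  have h2 : (∫ x, f x ∂(Φ.measure φ)) = (inner ℂ φ (Φ (ofRealC f) φ) : ℂ).re := h
  have hsa : star (Φ (ofRealC f)) = Φ (ofRealC f) := by
    rw [← map_star]
    congr 1
    ext x
    simp [ofRealC]
  have h3 : (starRingEnd ℂ) (inner ℂ φ (Φ (ofRealC f) φ)) = inner ℂ φ (Φ (ofRealC f) φ) := by
    rw [inner_conj_symm]
    nth_rewrite 1 [← hsa]
    rw [ContinuousLinearMap.star_eq_adjoint, ContinuousLinearMap.adjoint_inner_left]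
  rw [h2]
  exact Complex.conj_eq_iff_re.1 h3

lemma integrable_continuousMap (f : C(Ω, ℂ)) (μ : Measure Ω) [IsFiniteMeasure μ] :
    Integrable (fun x => f x) μ :=
  Integrable.of_bound f.continuous.aestronglyMeasurable ‖f‖
    (Eventually.of_forall fun x => f.norm_coe_le_norm x)

lemma integral_measure (f : C(Ω, ℂ)) (φ : H) :
    ∫ x, f x ∂(Φ.measure φ) = inner ℂ φ (Φ f φ) := by
  set f1 : C(Ω, ℝ) := ⟨fun x => (f x).re, by fun_prop⟩ with hf1
  set f2 : C(Ω, ℝ) := ⟨fun x => (f x).im, by fun_prop⟩ with hf2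
  have h : f = ofRealC f1 + Complex.I • ofRealC f2 := by
    ext x
    simp [ofRealC, hf1, hf2, mul_comm Complex.I, Complex.re_add_im]
  have h1 : ∫ x, f x ∂(Φ.measure φ) =
      ∫ x, ((f1 x : ℂ) + Complex.I * (f2 x : ℂ)) ∂(Φ.measure φ) := by
    congr 1
    ext x
    simp [hf1, hf2, mul_comm Complex.I, Complex.re_add_im]
  have h2 : Integrable (fun x => (f1 x : ℂ)) (Φ.measure φ) :=
    integrable_continuousMap (ofRealC f1) _
  have h3 : Integrable (fun x => Complex.I * (f2 x : ℂ)) (Φ.measure φ) :=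
    (integrable_continuousMap (ofRealC f2) _).const_mul _
  rw [h1, integral_add h2 h3, integral_const_mul,
    integral_complex_ofReal, integral_complex_ofReal, integral_ofRealC_measure,
    integral_ofRealC_measure, h, map_add, map_smul, add_apply, smul_apply, inner_add_right,
    inner_smul_right]

lemma measure_real_univ (φ : H) : (Φ.measure φ).real Set.univ = ‖φ‖ ^ 2 := by
  have h := Φ.integral_measure 1 φ
  rw [map_one, one_apply_eq_self, inner_self_eq_ofReal_norm_sq] at h
  simp only [ContinuousMap.one_apply, integral_const, Complex.real_smul, mul_one] at h
  exact_mod_cast h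

lemma norm_toLp (f : C(Ω, ℂ)) (φ : H) :
    ‖ContinuousMap.toLp 2 (Φ.measure φ) ℂ f‖ = ‖Φ f φ‖ := by
  have h1 : (inner ℂ (ContinuousMap.toLp 2 (Φ.measure φ) ℂ f)
      (ContinuousMap.toLp 2 (Φ.measure φ) ℂ f) : ℂ) = inner ℂ φ (Φ (star f * f) φ) := by
    rw [← integral_measure, L2.inner_def]
    refine integral_congr_ae ?_
    filter_upwards [ContinuousMap.coeFn_toLp (p := 2) (𝕜 := ℂ) (Φ.measure φ) f] with x hx
    rw [hx]
    exact mul_comm _ _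
  rw [← norm_apply_sq, inner_self_eq_ofReal_norm_sq] at h1
  have h2 : ‖ContinuousMap.toLp 2 (Φ.measure φ) ℂ f‖ ^ 2 = ‖Φ f φ‖ ^ 2 := by exact_mod_cast h1
  exact (sq_eq_sq₀ (norm_nonneg _) (norm_nonneg _)).1 h2

/-- The extension of `f ↦ Φ(f) φ` to `L²`. -/
noncomputable def cyclicMap (φ : H) : Lp ℂ 2 (Φ.measure φ) →L[ℂ] H :=
  (Φ.orbit φ).extendOfNorm (ContinuousMap.toLp 2 (Φ.measure φ) ℂ).toLinearMap

instance (φ : H) : (Φ.measure φ).WeaklyRegular := by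
  unfold measure; infer_instance

lemma denseRange_toLp (φ : H) :
    DenseRange (ContinuousMap.toLp 2 (Φ.measure φ) ℂ : C(Ω, ℂ) →L[ℂ] Lp ℂ 2 (Φ.measure φ)) :=
  ContinuousMap.toLp_denseRange ℂ _ ℂ (by norm_num)

lemma cyclicMap_toLp (f : C(Ω, ℂ)) (φ : H) :
    Φ.cyclicMap φ (ContinuousMap.toLp 2 (Φ.measure φ) ℂ f) = Φ f φ :=
  LinearMap.extendOfNorm_eq (Φ.denseRange_toLp φ)
    ⟨1, fun f => by
      rw [one_mul, orbit_apply]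
      exact (Φ.norm_toLp f φ).ge⟩ f

lemma norm_cyclicMap (φ : H) (g : Lp ℂ 2 (Φ.measure φ)) : ‖Φ.cyclicMap φ g‖ = ‖g‖ := by
  refine (Φ.denseRange_toLp φ).induction_on (p := fun g => ‖Φ.cyclicMap φ g‖ = ‖g‖) g
    (isClosed_eq (by fun_prop) (by fun_prop)) fun f => ?_
  rw [cyclicMap_toLp, norm_toLp]

lemma inner_cyclicMap (φ : H) (g h : Lp ℂ 2 (Φ.measure φ)) :
    inner ℂ (Φ.cyclicMap φ g) (Φ.cyclicMap φ h) = inner ℂ g h :=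
  LinearIsometry.inner_map_map ⟨(Φ.cyclicMap φ).toLinearMap, Φ.norm_cyclicMap φ⟩ g h

open Classical in
/-- The vector `g(Φ) φ`, for a function `g` that is square integrable for the spectral measure
of `φ`. -/
noncomputable def vec (φ : H) (g : Ω → ℂ) : H :=
  if h : MemLp g 2 (Φ.measure φ) then Φ.cyclicMap φ (h.toLp g) else 0

variable {Φ}

lemma vec_eq {φ : H} {g : Ω → ℂ} (h : MemLp g 2 (Φ.measure φ)) :
    Φ.vec φ g = Φ.cyclicMap φ (h.toLp g) := dif_pos h

lemma inner_vec {φ : H} {g h : Ω → ℂ} (hg : MemLp g 2 (Φ.measure φ))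
    (hh : MemLp h 2 (Φ.measure φ)) :
    inner ℂ (Φ.vec φ g) (Φ.vec φ h) = ∫ x, starRingEnd ℂ (g x) * h x ∂(Φ.measure φ) := by
  rw [vec_eq hg, vec_eq hh, inner_cyclicMap, L2.inner_def]
  refine integral_congr_ae ?_
  filter_upwards [hg.coeFn_toLp, hh.coeFn_toLp] with x h1 h2
  rw [h1, h2, RCLike.inner_apply, mul_comm]

lemma vec_congr_ae {φ : H} {g h : Ω → ℂ} (hgh : g =ᵐ[Φ.measure φ] h) :
    Φ.vec φ g = Φ.vec φ h := by
  by_cases hg : MemLp g 2 (Φ.measure φ)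
  · rw [vec_eq hg, vec_eq (hg.ae_eq hgh)]
    congr 1
    exact MemLp.toLp_congr _ _ hgh
  · have hh : ¬MemLp h 2 (Φ.measure φ) := fun h => hg (h.ae_eq hgh.symm)
    rw [vec, vec, dif_neg hg, dif_neg hh]

lemma vec_add_fun {φ : H} {g h : Ω → ℂ} (hg : MemLp g 2 (Φ.measure φ))
    (hh : MemLp h 2 (Φ.measure φ)) : Φ.vec φ (g + h) = Φ.vec φ g + Φ.vec φ h := by
  rw [vec_eq hg, vec_eq hh, vec_eq (hg.add hh), MemLp.toLp_add, map_add]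

lemma memLp_continuousMap (f : C(Ω, ℂ)) (μ : Measure Ω) [IsFiniteMeasure μ] : MemLp f 2 μ :=
  MemLp.of_bound f.continuous.aestronglyMeasurable ‖f‖
    (Eventually.of_forall fun x => f.norm_coe_le_norm x)

lemma vec_continuousMap (f : C(Ω, ℂ)) (φ : H) : Φ.vec φ f = Φ f φ := by
  rw [vec_eq (memLp_continuousMap f _), ← cyclicMap_toLp]
  rfl

lemma tendsto_vec {φ : H} {g : Ω → ℂ} (hg : MemLp g 2 (Φ.measure φ)) {f : ℕ → Ω → ℂ}
    (hf : ∀ n, MemLp (f n) 2 (Φ.measure φ))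
    (h : Tendsto (fun n => eLpNorm (g - f n) 2 (Φ.measure φ)) atTop (𝓝 0)) :
    Tendsto (fun n => Φ.vec φ (f n)) atTop (𝓝 (Φ.vec φ g)) := by
  simp only [vec_eq hg, vec_eq (hf _)]
  refine ((Φ.cyclicMap φ).continuous.tendsto _).comp ?_
  rw [Lp.tendsto_Lp_iff_tendsto_eLpNorm'' f hf g hg]
  refine h.congr fun n => ?_
  rw [← eLpNorm_neg, neg_sub]

lemma exists_tendsto_eLpNorm (μ : Measure Ω) [IsFiniteMeasure μ] {g : Ω → ℂ} (hg : MemLp g 2 μ) :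
    ∃ f : ℕ → C(Ω, ℂ), Tendsto (fun n => eLpNorm (g - ⇑(f n)) 2 μ) atTop (𝓝 0) := by
  have h : ∀ n : ℕ, ∃ f : C(Ω, ℂ), eLpNorm (g - ⇑f) 2 μ ≤ ((n : ℝ≥0∞) + 1)⁻¹ := fun n => by
    obtain ⟨f, hf, -⟩ := hg.exists_boundedContinuous_eLpNorm_sub_le (by norm_num)
      (ε := ((n : ℝ≥0∞) + 1)⁻¹) (by simp)
    exact ⟨f.toContinuousMap, hf⟩
  choose f hf using h
  refine ⟨f, tendsto_of_tendsto_of_tendsto_of_le_of_le tendsto_const_nhds ?_ (fun _ => zero_le)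
    hf⟩
  have h2 := (tendsto_add_atTop_iff_nat 1).2 ENNReal.tendsto_inv_nat_nhds_zero
  simpa using h2

/-- Simultaneous approximation of `g(Φ)` on three vectors. -/
lemma exists_tendsto_vec {φ ψ χ : H} {g : Ω → ℂ} (h1 : MemLp g 2 (Φ.measure φ))
    (h2 : MemLp g 2 (Φ.measure ψ)) (h3 : MemLp g 2 (Φ.measure χ)) :
    ∃ f : ℕ → C(Ω, ℂ), Tendsto (fun n => Φ (f n) φ) atTop (𝓝 (Φ.vec φ g)) ∧
      Tendsto (fun n => Φ (f n) ψ) atTop (𝓝 (Φ.vec ψ g)) ∧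
      Tendsto (fun n => Φ (f n) χ) atTop (𝓝 (Φ.vec χ g)) := by
  obtain ⟨f, hf⟩ := exists_tendsto_eLpNorm (Φ.measure φ + Φ.measure ψ + Φ.measure χ)
    (memLp_add_measure (memLp_add_measure h1 h2) h3)
  have key : ∀ η, MemLp g 2 (Φ.measure η) →
      Φ.measure η ≤ Φ.measure φ + Φ.measure ψ + Φ.measure χ →
      Tendsto (fun n => Φ (f n) η) atTop (𝓝 (Φ.vec η g)) := fun η hη hle => by
    simpa only [vec_continuousMap] using tendsto_vec hη (fun n => memLp_continuousMap (f n) _)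
      (tendsto_eLpNorm_of_le hle hf)
  exact ⟨f, key φ h1 ((Measure.le_add_right le_rfl).trans (Measure.le_add_right le_rfl)),
    key ψ h2 ((Measure.le_add_left le_rfl).trans (Measure.le_add_right le_rfl)),
    key χ h3 (Measure.le_add_left le_rfl)⟩

lemma vec_add {φ ψ : H} {g : Ω → ℂ} (h1 : MemLp g 2 (Φ.measure φ))
    (h2 : MemLp g 2 (Φ.measure ψ)) (h3 : MemLp g 2 (Φ.measure (φ + ψ))) :
    Φ.vec (φ + ψ) g = Φ.vec φ g + Φ.vec ψ g := by
  obtain ⟨f, a1, a2, a3⟩ := exists_tendsto_vec h1 h2 h3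
  exact tendsto_nhds_unique a3 (by simpa only [map_add] using a1.add a2)

lemma vec_smul {φ : H} (c : ℂ) {g : Ω → ℂ} (h1 : MemLp g 2 (Φ.measure φ))
    (h2 : MemLp g 2 (Φ.measure (c • φ))) : Φ.vec (c • φ) g = c • Φ.vec φ g := by
  obtain ⟨f, a1, a2, -⟩ := exists_tendsto_vec h1 h2 h2
  exact tendsto_nhds_unique a2 (by simpa only [map_smul] using a1.const_smul c)

lemma vec_apply {φ : H} (k : C(Ω, ℂ)) {g : Ω → ℂ} (h1 : MemLp g 2 (Φ.measure φ))
    (h2 : MemLp g 2 (Φ.measure (Φ k φ))) : Φ.vec (Φ k φ) g = Φ k (Φ.vec φ g) := by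
  obtain ⟨f, a1, a2, -⟩ := exists_tendsto_vec h1 h2 h2
  refine tendsto_nhds_unique a2 ((((Φ k).continuous.tendsto _).comp a1).congr fun n => ?_)
  simp only [Function.comp_apply]
  rw [← mul_apply_eq_comp, ← mul_apply_eq_comp, ← map_mul, ← map_mul, mul_comm]

lemma inner_vec_right {φ ψ : H} {g : Ω → ℂ} (hg : ∀ x, starRingEnd ℂ (g x) = g x)
    (h1 : MemLp g 2 (Φ.measure φ)) (h2 : MemLp g 2 (Φ.measure ψ)) :
    inner ℂ (Φ.vec ψ g) φ = inner ℂ ψ (Φ.vec φ g) := by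
  obtain ⟨f, hf⟩ := exists_tendsto_eLpNorm (Φ.measure φ + Φ.measure ψ) (memLp_add_measure h1 h2)
  have hf' : Tendsto (fun n => eLpNorm (g - ⇑(star (f n))) 2
      (Φ.measure φ + Φ.measure ψ)) atTop (𝓝 0) := by
    refine hf.congr fun n => eLpNorm_congr_norm_ae (Eventually.of_forall fun x => ?_)
    rw [Pi.sub_apply, Pi.sub_apply, ← RCLike.norm_conj, map_sub, hg]
    rfl
  have a1 := tendsto_vec h1 (fun n => memLp_continuousMap (f n) _)
    (tendsto_eLpNorm_of_le (Measure.le_add_right le_rfl) hf)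
  have a2 := tendsto_vec h2 (fun n => memLp_continuousMap (star (f n)) _)
    (tendsto_eLpNorm_of_le (Measure.le_add_left le_rfl) hf')
  simp only [vec_continuousMap] at a1 a2
  refine tendsto_nhds_unique (a2.inner tendsto_const_nhds)
    ((tendsto_const_nhds.inner a1).congr fun n => ?_)
  rw [map_star, ContinuousLinearMap.star_eq_adjoint, ContinuousLinearMap.adjoint_inner_left]

lemma memLp_continuousMap_mul (k : C(Ω, ℂ)) {μ : Measure Ω} {g : Ω → ℂ} (hg : MemLp g 2 μ) :
    MemLp (fun x => k x * g x) 2 μ :=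
  MemLp.of_le_mul (c := ‖k‖) hg (k.continuous.aestronglyMeasurable.mul hg.1)
    (Eventually.of_forall fun x => by
      rw [norm_mul]
      gcongr
      exact k.norm_coe_le_norm x)

lemma apply_vec {φ : H} (k : C(Ω, ℂ)) {g : Ω → ℂ} (h : MemLp g 2 (Φ.measure φ)) :
    Φ k (Φ.vec φ g) = Φ.vec φ fun x => k x * g x := by
  obtain ⟨f, hf⟩ := exists_tendsto_eLpNorm (Φ.measure φ) h
  have a1 := tendsto_vec h (fun n => memLp_continuousMap (f n) _) hf
  have a2 : Tendsto (fun n => eLpNorm ((fun x => k x * g x) - ⇑(k * f n)) 2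
      (Φ.measure φ)) atTop (𝓝 0) := by
    have h0 := ENNReal.Tendsto.const_mul (a := ENNReal.ofReal ‖k‖) hf (Or.inr ENNReal.ofReal_ne_top)
    rw [mul_zero] at h0
    refine tendsto_of_tendsto_of_tendsto_of_le_of_le tendsto_const_nhds h0
      (fun _ => zero_le) fun n => eLpNorm_le_mul_eLpNorm_of_ae_le_mul
        (Eventually.of_forall fun x => ?_) _
    simp only [Pi.sub_apply, ContinuousMap.mul_apply, ← mul_sub, norm_mul]
    gcongr
    exact k.norm_coe_le_norm x
  have a3 := tendsto_vec (memLp_continuousMap_mul k h)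
    (fun n => memLp_continuousMap (k * f n) _) a2
  simp only [vec_continuousMap] at a1 a3
  refine tendsto_nhds_unique (((Φ k).continuous.tendsto _).comp a1) (a3.congr fun n => ?_)
  rw [map_mul]
  rfl

end StarAlgHom

namespace StarAlgHom

lemma memLp_indicator_one {Ω : Type v} [MeasurableSpace Ω] {Δ : Set Ω} (hΔ : MeasurableSet Δ)
    (μ : Measure Ω) [IsFiniteMeasure μ] :
    MemLp (Δ.indicator fun _ => (1 : ℂ)) 2 μ :=
  (memLp_const 1).indicator hΔ

variable {Ω : Type v} [MetricSpace Ω] [CompactSpace Ω] [MeasurableSpace Ω] [BorelSpace Ω]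
  {H : Type u} [NormedAddCommGroup H] [InnerProductSpace ℂ H] [CompleteSpace H]
  (Φ : C(Ω, ℂ) →⋆ₐ[ℂ] (H →L[ℂ] H))

variable {Φ} in
lemma norm_vec_indicator_sq {Δ : Set Ω} (hΔ : MeasurableSet Δ) (φ : H) :
    ‖Φ.vec φ (Δ.indicator fun _ => 1)‖ ^ 2 = (Φ.measure φ).real Δ := by
  have h := inner_vec (memLp_indicator_one hΔ (Φ.measure φ)) (memLp_indicator_one hΔ _)
  have h2 : (fun x => (starRingEnd ℂ) (Δ.indicator (fun _ => (1 : ℂ)) x) *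
      Δ.indicator (fun _ => (1 : ℂ)) x) = Δ.indicator fun _ => (1 : ℂ) := by
    ext x
    by_cases hx : x ∈ Δ <;> simp [hx]
  rw [h2, integral_indicator_const _ hΔ, inner_self_eq_ofReal_norm_sq, Complex.real_smul,
    mul_one] at h
  exact_mod_cast h

/-- The spectral projection of a Borel set `Δ ⊆ Ω`. -/
noncomputable def specProj (Δ : Set Ω) (hΔ : MeasurableSet Δ) : H →L[ℂ] H :=
  LinearMap.mkContinuous
    { toFun := fun φ => Φ.vec φ (Δ.indicator fun _ => 1)
      map_add' := fun _ _ => vec_add (memLp_indicator_one hΔ _) (memLp_indicator_one hΔ _)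
        (memLp_indicator_one hΔ _)
      map_smul' := fun c _ => vec_smul c (memLp_indicator_one hΔ _) (memLp_indicator_one hΔ _) }
    1 (fun φ => by
      rw [one_mul]
      refine abs_le_of_sq_le_sq' ?_ (norm_nonneg _) |>.2
      change ‖Φ.vec φ (Δ.indicator fun _ => 1)‖ ^ 2 ≤ _
      rw [norm_vec_indicator_sq hΔ, ← Φ.measure_real_univ]
      exact measureReal_mono (Set.subset_univ _))

lemma specProj_apply {Δ : Set Ω} (hΔ : MeasurableSet Δ) (φ : H) :
    Φ.specProj Δ hΔ φ = Φ.vec φ (Δ.indicator fun _ => 1) := rfl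

lemma norm_specProj_sq {Δ : Set Ω} (hΔ : MeasurableSet Δ) (φ : H) :
    ‖Φ.specProj Δ hΔ φ‖ ^ 2 = (Φ.measure φ).real Δ := norm_vec_indicator_sq hΔ φ

lemma vec_one (φ : H) : Φ.vec φ (fun _ => 1) = φ := by
  have h := vec_continuousMap (Φ := Φ) 1 φ
  rwa [map_one] at h

lemma inner_specProj_left {Δ : Set Ω} (hΔ : MeasurableSet Δ) (ψ φ : H) :
    inner ℂ (Φ.specProj Δ hΔ ψ) φ = inner ℂ ψ (Φ.specProj Δ hΔ φ) :=
  inner_vec_right (fun x => by by_cases hx : x ∈ Δ <;> simp [hx])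
    (memLp_indicator_one hΔ _) (memLp_indicator_one hΔ _)

lemma isStarProjection_specProj {Δ : Set Ω} (hΔ : MeasurableSet Δ) :
    IsStarProjection (Φ.specProj Δ hΔ) := by
  have hsym : (Φ.specProj Δ hΔ).toLinearMap.IsSymmetric := Φ.inner_specProj_left hΔ
  refine ⟨?_, hsym.isSelfAdjoint⟩
  have h0 : (Φ.specProj Δ hΔ * Φ.specProj Δ hΔ - Φ.specProj Δ hΔ).toLinearMap = 0 := by
    rw [← inner_map_self_eq_zero]
    intro φ
    change inner ℂ (Φ.specProj Δ hΔ (Φ.specProj Δ hΔ φ) - Φ.specProj Δ hΔ φ) φ = 0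
    have h1 : inner ℂ (Φ.specProj Δ hΔ φ) φ = (((Φ.measure φ).real Δ : ℝ) : ℂ) := by
      nth_rewrite 2 [← Φ.vec_one φ]
      rw [specProj_apply, inner_vec (memLp_indicator_one hΔ _) (memLp_const 1)]
      have h2 : (fun x => (starRingEnd ℂ) (Δ.indicator (fun _ => (1 : ℂ)) x) * 1) =
          Δ.indicator fun _ => (1 : ℂ) := by
        ext x
        by_cases hx : x ∈ Δ <;> simp [hx]
      rw [h2, integral_indicator_const _ hΔ, Complex.real_smul, mul_one]
    rw [inner_sub_left, inner_specProj_left, inner_self_eq_ofReal_norm_sq, norm_specProj_sq, h1,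
      sub_self]
  have h1 : Φ.specProj Δ hΔ * Φ.specProj Δ hΔ - Φ.specProj Δ hΔ = 0 :=
    ContinuousLinearMap.coe_injective h0
  exact sub_eq_zero.1 h1

lemma specProj_union {A B : Set Ω} (hA : MeasurableSet A) (hB : MeasurableSet B)
    (h : Disjoint A B) (φ : H) :
    Φ.specProj (A ∪ B) (hA.union hB) φ = Φ.specProj A hA φ + Φ.specProj B hB φ := by
  rw [specProj_apply, specProj_apply, specProj_apply, Set.indicator_union_of_disjoint h]
  exact vec_add_fun (memLp_indicator_one hA _) (memLp_indicator_one hB _)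

lemma specProj_biUnion_finset {f : ℕ → Set Ω} (hf : ∀ n, MeasurableSet (f n))
    (hd : Pairwise (Function.onFun Disjoint f)) (s : Finset ℕ) (φ : H) :
    Φ.specProj (⋃ n ∈ s, f n) (s.measurableSet_biUnion fun n _ => hf n) φ =
      ∑ n ∈ s, Φ.specProj (f n) (hf n) φ := by
  classical
  induction s using Finset.induction_on with
  | empty =>
    have h := Φ.norm_specProj_sq MeasurableSet.empty φ
    simp only [measureReal_empty] at h
    simpa using h
  | insert a s ha ih =>
    have hdisj : Disjoint (f a) (⋃ n ∈ s, f n) := by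
      rw [Set.disjoint_iUnion₂_right]
      exact fun n hn => hd fun h => ha (h ▸ hn)
    rw [Finset.sum_insert ha, ← ih,
      ← Φ.specProj_union (hf a) (s.measurableSet_biUnion fun n _ => hf n) hdisj]
    simp only [Finset.set_biUnion_insert]

lemma hasSum_specProj {f : ℕ → Set Ω} (hf : ∀ n, MeasurableSet (f n))
    (hd : Pairwise (Function.onFun Disjoint f)) (φ : H) :
    HasSum (fun n => Φ.specProj (f n) (hf n) φ) (Φ.specProj (⋃ n, f n) (.iUnion hf) φ) := by
  set μ := Φ.measure φ
  have hU : ∀ s : Finset ℕ, MeasurableSet (⋃ n ∈ s, f n) :=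
    fun s => s.measurableSet_biUnion fun n _ => hf n
  have hsub : ∀ s : Finset ℕ, (⋃ n ∈ s, f n) ⊆ ⋃ n, f n :=
    fun s => Set.iUnion₂_subset fun n _ => Set.subset_iUnion f n
  have hμ : HasSum (fun n => μ.real (f n)) (μ.real (⋃ n, f n)) := by
    have h1 := measure_iUnion (μ := μ) hd hf
    have h2 : ∑' n, μ (f n) ≠ ∞ := h1 ▸ measure_ne_top μ _
    have h3 := ENNReal.hasSum_toReal h2
    rwa [← ENNReal.tsum_toReal_eq fun n => measure_ne_top μ _, ← h1] at h3
  have key : ∀ s : Finset ℕ, ‖∑ n ∈ s, Φ.specProj (f n) (hf n) φ -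
      Φ.specProj (⋃ n, f n) (.iUnion hf) φ‖ ^ 2 = μ.real (⋃ n, f n) - ∑ n ∈ s, μ.real (f n) := by
    intro s
    have h1 := Φ.specProj_union (hU s) ((MeasurableSet.iUnion hf).diff (hU s))
      Set.disjoint_sdiff_right φ
    simp only [Set.union_sdiff_cancel (hsub s)] at h1
    rw [← Φ.specProj_biUnion_finset hf hd, h1, sub_add_cancel_left, norm_neg, norm_specProj_sq,
      measureReal_sdiff (hsub s) (hU s), measureReal_biUnion_finset (hd.set_pairwise _)
        fun n _ => hf n]
  rw [HasSum, SummationFilter.unconditional_filter, tendsto_iff_norm_sub_tendsto_zero]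
  have h1 : Tendsto (fun s : Finset ℕ => μ.real (⋃ n, f n) - ∑ n ∈ s, μ.real (f n)) atTop (𝓝 0) := by
    have h2 : Tendsto (fun s : Finset ℕ => ∑ n ∈ s, μ.real (f n)) atTop
        (𝓝 (μ.real (⋃ n, f n))) := by
      simpa only [HasSum, SummationFilter.unconditional_filter] using hμ
    simpa using h2.const_sub (μ.real (⋃ n, f n))
  have h3 := h1.sqrt
  rw [Real.sqrt_zero] at h3
  refine h3.congr fun s => ?_
  rw [← key, Real.sqrt_sq (norm_nonneg _)]

open Classical in
/-- The projection-valued measure on `ℝ` that is the image of the spectral measure of `Φ` under a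
Borel function. -/
noncomputable def toPVM (x : Ω → ℝ) (hx : Measurable x) : PVM H where
  proj B := if hB : MeasurableSet B then Φ.specProj (x ⁻¹' B) (hx hB) else 0
  isStarProjection B := by
    split_ifs with hB
    · exact Φ.isStarProjection_specProj _
    · exact IsStarProjection.zero _
  not_measurable B hB := dif_neg hB
  proj_univ := by
    ext φ
    rw [dif_pos MeasurableSet.univ]
    simp only [Set.preimage_univ]
    rw [specProj_apply, Set.indicator_univ, vec_one]
    rfl
  hasSum_iUnion f hf hd φ := by
    simp only [hf, MeasurableSet.iUnion hf, dif_pos, Set.preimage_iUnion]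
    exact Φ.hasSum_specProj (fun n => hx (hf n)) (fun i j hij => (hd hij).preimage x) φ

lemma scalarMeasure_toPVM {x : Ω → ℝ} (hx : Measurable x) (φ : H) :
    (Φ.toPVM x hx).scalarMeasure φ = (Φ.measure φ).map x := by
  ext B hB
  have h : (Φ.toPVM x hx).proj B = Φ.specProj (x ⁻¹' B) (hx hB) := dif_pos hB
  rw [PVM.scalarMeasure_apply _ _ hB, Measure.map_apply hx hB, h, norm_specProj_sq,
    ofReal_measureReal]

lemma measure_apply_eq_withDensity (k : C(Ω, ℂ)) (φ : H) :
    Φ.measure (Φ k φ) = (Φ.measure φ).withDensity fun x => ‖k x‖ₑ ^ 2 := by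
  ext Δ hΔ
  rw [withDensity_apply _ hΔ, ← ofReal_measureReal (μ := Φ.measure (Φ k φ)),
    ← norm_vec_indicator_sq hΔ,
    vec_apply k (memLp_indicator_one hΔ _) (memLp_indicator_one hΔ _),
    apply_vec k (memLp_indicator_one hΔ _)]
  have hm := memLp_continuousMap_mul k (memLp_indicator_one hΔ (Φ.measure φ))
  rw [vec_eq hm, norm_cyclicMap, ENNReal.ofReal_pow (norm_nonneg _), ofReal_norm,
    Lp.enorm_toLp, eLpNorm_eq_lintegral_rpow_enorm_toReal (by norm_num) (by norm_num)]
  rw [← ENNReal.rpow_natCast, ← ENNReal.rpow_mul, ← lintegral_indicator hΔ]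
  norm_num
  refine lintegral_congr fun x => ?_
  by_cases hx : x ∈ Δ <;> simp [hx]

end StarAlgHom

section SpectralTheorem

variable {H : Type u} [NormedAddCommGroup H] [InnerProductSpace ℂ H] [CompleteSpace H]

/-- The spectral theorem for unbounded self-adjoint operators. -/
theorem IsSelfAdjoint.exists_isSpectralMeasureOf {A : H →ₗ.[ℂ] H} (hA : IsSelfAdjoint A) :
    ∃ E : PVM H, E.IsSpectralMeasureOf A := by
  obtain ⟨R, hR1, hR2, hR3, hR4⟩ := hA.exists_normal_resolvent
  have hRn : IsStarNormal R := ⟨hR4⟩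
  let Φ : C(spectrum ℂ R, ℂ) →⋆ₐ[ℂ] (H →L[ℂ] H) := cfcHom hRn
  let k : C(spectrum ℂ R, ℂ) := (ContinuousMap.id ℂ).restrict (spectrum ℂ R)
  have hk : Φ k = R := cfcHom_id hRn
  have hkid : ∀ z : spectrum ℂ R, starRingEnd ℂ (z : ℂ) - z =
      2 * Complex.I * (starRingEnd ℂ (z : ℂ) * z) := by
    have h1 : star k - k = (2 * Complex.I) • (star k * k) := by
      apply cfcHom_injective hRn
      change Φ _ = Φ _
      rw [map_sub, map_smul, map_mul, map_star, hk, hR3]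
    exact fun z => DFunLike.congr_fun h1 z
  let x : spectrum ℂ R → ℝ := fun z => ((z : ℂ)⁻¹).re
  have hx : Measurable x := Complex.measurable_re.comp (measurable_inv.comp measurable_subtype_coe)
  have hxz : ∀ z : spectrum ℂ R, (z : ℂ) ≠ 0 → (z : ℂ) * ((x z : ℂ) + Complex.I) = 1 := by
    intro z hz
    have hz' : starRingEnd ℂ (z : ℂ) ≠ 0 := by simpa using hz
    have h1 : (z : ℂ)⁻¹ - starRingEnd ℂ (z : ℂ)⁻¹ = 2 * Complex.I := by
      rw [map_inv₀]
      field_simp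
      linear_combination hkid z
    have h2 : ((z : ℂ)⁻¹).im = 1 := by
      have := congrArg Complex.im h1
      rw [Complex.sub_im, Complex.conj_im] at this
      have h3 : (2 * Complex.I).im = 2 := by simp
      linarith
    have h3 : (x z : ℂ) + Complex.I = (z : ℂ)⁻¹ := by
      apply Complex.ext <;> simp [x, h2]
    rw [h3, mul_inv_cancel₀ hz]
  have hRinj : ∀ φ, R φ = 0 → φ = 0 := by
    intro φ h
    obtain ⟨h1, h2⟩ := hR2 φ
    have h3 : (⟨R φ, h1⟩ : A.domain) = 0 := Subtype.ext h
    rw [h3, h, LinearPMap.map_zero, smul_zero, add_zero] at h2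
    exact h2.symm
  have hne : ∀ φ, ∀ᵐ z : spectrum ℂ R ∂(Φ.measure φ), (z : ℂ) ≠ 0 := by
    intro φ
    have hΔ : MeasurableSet {z : spectrum ℂ R | (z : ℂ) = 0} :=
      measurable_subtype_coe (measurableSet_singleton (0 : ℂ))
    have h1 := StarAlgHom.apply_vec (φ := φ) k (StarAlgHom.memLp_indicator_one hΔ (Φ.measure φ))
    have h2 : (fun z => k z * {z : spectrum ℂ R | (z : ℂ) = 0}.indicator (fun _ => (1 : ℂ)) z) =
        ((0 : C(spectrum ℂ R, ℂ)) : spectrum ℂ R → ℂ) := by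
      ext z
      by_cases hz : (z : ℂ) = 0
      · simp [k, hz]
      · simp [hz]
    rw [h2, StarAlgHom.vec_continuousMap, map_zero, hk] at h1
    have h3 := StarAlgHom.norm_vec_indicator_sq (Φ := Φ) hΔ φ
    rw [hRinj _ h1, norm_zero] at h3
    have h4 : (Φ.measure φ) {z : spectrum ℂ R | (z : ℂ) = 0} = 0 := by
      rw [← measureReal_eq_zero_iff, ← h3]
      norm_num
    rw [ae_iff]
    simpa using h4
  have hmem : ∀ φ, MemLp (fun z => (x z : ℂ) + Complex.I) 2 (Φ.measure φ) ↔
      Integrable (fun y : ℝ => y ^ 2) ((Φ.toPVM x hx).scalarMeasure φ) := by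
    intro φ
    rw [Φ.scalarMeasure_toPVM, integrable_map_measure (by fun_prop) hx.aemeasurable,
      memLp_two_iff_integrable_sq_norm (by fun_prop)]
    have h : ∀ z, ‖(x z : ℂ) + Complex.I‖ ^ 2 = x z ^ 2 + 1 := fun z => by
      rw [← Complex.normSq_eq_norm_sq, Complex.normSq_apply]
      simp [sq]
    simp only [h]
    constructor
    · intro h
      refine (h.sub (integrable_const (1 : ℝ))).congr (Eventually.of_forall fun z => ?_)
      simp
    · exact fun h => h.add (integrable_const _)
  have hvec : ∀ φ, MemLp (fun z => (x z : ℂ) + Complex.I) 2 (Φ.measure φ) →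
      R (Φ.vec φ fun z => (x z : ℂ) + Complex.I) = φ := by
    intro φ h
    refine (DFunLike.congr_fun hk.symm _).trans ?_
    rw [StarAlgHom.apply_vec k h]
    conv_rhs => rw [← Φ.vec_one φ]
    refine StarAlgHom.vec_congr_ae ?_
    filter_upwards [hne φ] with z hz
    exact hxz z hz
  have hdom : ∀ φ, φ ∈ A.domain ↔ MemLp (fun z => (x z : ℂ) + Complex.I) 2 (Φ.measure φ) := by
    intro φ
    constructor
    · intro hφ
      have h1 : Φ k (A ⟨φ, hφ⟩ + Complex.I • φ) = φ :=
        (DFunLike.congr_fun hk _).trans (hR1 ⟨φ, hφ⟩)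
      rw [← h1]
      refine ⟨by fun_prop, ?_⟩
      rw [eLpNorm_lt_top_iff_lintegral_rpow_enorm_lt_top (by norm_num) (by norm_num),
        StarAlgHom.measure_apply_eq_withDensity, lintegral_withDensity_eq_lintegral_mul _
          (by fun_prop) (by fun_prop)]
      refine lt_of_le_of_lt (lintegral_mono_ae (g := fun _ => 1) ?_) (by simp)
      filter_upwards [hne _] with z hz
      have h2 := congrArg (fun w => ‖w‖ₑ) (hxz z hz)
      simp only [enorm_mul, enorm_one] at h2
      have h3 : ‖k z‖ₑ * ‖(x z : ℂ) + Complex.I‖ₑ = 1 := h2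
      simp only [Pi.mul_apply, ENNReal.toReal_ofNat, ENNReal.rpow_ofNat]
      rw [← mul_pow, h3, one_pow]
    · intro h
      rw [← hvec φ h]
      exact (hR2 _).1
  refine ⟨Φ.toPVM x hx, fun φ => (hdom φ).trans (hmem φ), fun φ => ?_⟩
  have hφ := (hdom φ).1 φ.2
  have h1 : A φ + Complex.I • (φ : H) = Φ.vec φ fun z => (x z : ℂ) + Complex.I := by
    refine sub_eq_zero.1 (hRinj _ ?_)
    rw [map_sub, hR1, hvec _ hφ, sub_self]
  have h2 : inner ℂ (φ : H) (A φ + Complex.I • (φ : H)) =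
      ∫ z, ((x z : ℂ) + Complex.I) ∂(Φ.measure (φ : H)) := by
    rw [h1]
    nth_rewrite 1 [← Φ.vec_one (φ : H)]
    rw [StarAlgHom.inner_vec (memLp_const 1) hφ]
    simp
  have h3 : Integrable (fun z => (x z : ℂ)) (Φ.measure (φ : H)) := by
    refine ((hφ.integrable (by norm_num)).sub (integrable_const Complex.I)).congr
      (Eventually.of_forall fun z => ?_)
    simp
  rw [integral_add h3 (integrable_const _), inner_add_right, inner_smul_right,
    inner_self_eq_ofReal_norm_sq, integral_const, Φ.measure_real_univ, Complex.real_smul,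
    integral_complex_ofReal, mul_comm Complex.I, add_left_inj] at h2
  rw [h2, Φ.scalarMeasure_toPVM, integral_map hx.aemeasurable (by fun_prop)]

lemma isSpectralMeasureOf_spectralMeasure {A : H →ₗ.[ℂ] H} (hA : IsSelfAdjoint A) :
    (spectralMeasure A).IsSpectralMeasureOf A :=
  Classical.epsilon_spec hA.exists_isSpectralMeasureOf

end SpectralTheorem

section Cutoffs

variable {G : Type u} [NormedAddCommGroup G] [InnerProductSpace ℂ G]

lemma LinearPMap.isFormalAdjoint_self_of_cutoffs {S : G →ₗ.[ℂ] G} {P B : ℕ → G →L[ℂ] G}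
    (hP : ∀ u, Tendsto (fun n => P n u) atTop (𝓝 u))
    (hB : ∀ n u v, inner ℂ (B n u) v = inner ℂ u (B n v))
    (hPS : ∀ n (u : S.domain), P n (S u) = B n u) : S.IsFormalAdjoint S := by
  intro u v
  refine tendsto_nhds_unique ((hP (S u)).inner tendsto_const_nhds) ?_
  refine (tendsto_const_nhds.inner (hP (S v))).congr fun n => ?_
  rw [hPS, hPS, hB]

/-- An operator whose composition with a sequence of cutoffs `P n → 1` is bounded and symmetric is
essentially self-adjoint. -/
theorem LinearPMap.isSelfAdjoint_closure_of_cutoffs [CompleteSpace G] {S : G →ₗ.[ℂ] G}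
    {P B : ℕ → G →L[ℂ] G} {D : Set G} (hD : Dense D)
    (hP : ∀ u, Tendsto (fun n => P n u) atTop (𝓝 u))
    (hPs : ∀ n u v, inner ℂ (P n u) v = inner ℂ u (P n v))
    (hB : ∀ n u v, inner ℂ (B n u) v = inner ℂ u (B n v))
    (hPS : ∀ n (u : S.domain), P n (S u) = B n u)
    (hS : ∀ n, ∀ u ∈ D, (P n u, B n u) ∈ S.graph) :
    IsSelfAdjoint S.closure ∧ ∀ n u, (P n u, B n u) ∈ S.closure.graph := by
  have hdense : Dense (S.domain : Set G) := by
    have h : D ⊆ _root_.closure (S.domain : Set G) := fun u hu => by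
      refine mem_closure_of_tendsto (hP u) (Eventually.of_forall fun n => ?_)
      obtain ⟨y, hy, -⟩ := (LinearPMap.mem_graph_iff S).1 (hS n u hu)
      have h2 := y.2
      rw [hy] at h2
      exact h2
    exact dense_closure.1 (hD.mono h)
  have hle : S ≤ S.adjoint :=
    (isFormalAdjoint_self_of_cutoffs hP hB hPS).le_adjoint hdense
  have hcl : S.IsClosable := (adjoint_isClosed hdense).isClosable.leIsClosable hle
  have hclosed : _root_.IsClosed (S.closure.graph : Set (G × G)) := hcl.closure_isClosed
  have hdense' : Dense (S.closure.domain : Set G) := hdense.mono S.le_closure.1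
  have hPZ : ∀ n (u : S.closure.domain), P n (S.closure u) = B n u := by
    intro n u
    have h1 : (u.1, S.closure u) ∈ S.graph.topologicalClosure := by
      rw [hcl.graph_closure_eq_closure_graph]
      exact S.closure.mem_graph u
    have h2 : _root_.IsClosed {p : G × G | P n p.2 = B n p.1} :=
      isClosed_eq (by fun_prop) (by fun_prop)
    refine closure_minimal (fun p hp => ?_) h2 h1
    obtain ⟨y, hy1, hy2⟩ := (LinearPMap.mem_graph_iff S).1 hp
    change P n p.2 = B n p.1
    rw [← hy1, ← hy2, hPS]
  have hZ : ∀ n u, (P n u, B n u) ∈ S.closure.graph := by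
    intro n u
    have h1 : _root_.IsClosed {u : G | (P n u, B n u) ∈ S.closure.graph} :=
      hclosed.preimage (by fun_prop : Continuous fun u => (P n u, B n u))
    refine h1.closure_subset_iff.2 (fun u hu => ?_) (hD u)
    exact LinearPMap.le_graph_of_le S.le_closure (hS n u hu)
  refine ⟨LinearPMap.isSelfAdjoint_def.2 (le_antisymm ?_ ?_), hZ⟩
  · refine LinearPMap.le_of_le_graph fun p hp => ?_
    obtain ⟨v, hv1, hv2⟩ := (LinearPMap.mem_graph_iff _).1 hp
    have h1 : ∀ n, P n p.2 = B n p.1 := by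
      intro n
      refine ext_inner_right ℂ fun u => ?_
      obtain ⟨y, hy1, hy2⟩ := (LinearPMap.mem_graph_iff _).1 (hZ n u)
      have h2 := adjoint_isFormalAdjoint hdense' v y
      rw [hv1, hv2, hy1, hy2] at h2
      rw [hPs, h2, hB]
    have h3 : Tendsto (fun n => (P n p.1, B n p.1)) atTop (𝓝 (p.1, p.2)) :=
      (hP p.1).prodMk_nhds (by simpa only [h1] using hP p.2)
    exact hclosed.mem_of_tendsto h3 (Eventually.of_forall fun n => hZ n p.1)
  · exact (isFormalAdjoint_self_of_cutoffs hP hB hPZ).le_adjoint hdense'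

end Cutoffs

section Exponential

variable {H : Type u} [NormedAddCommGroup H] [InnerProductSpace ℂ H] [CompleteSpace H]

lemma expNegI_cutProj (A : H →ₗ.[ℂ] H) (t : ℝ) (n : ℕ) (φ : H) :
    expNegI A t ((spectralMeasure A).cutProj n φ) =
      NormedSpace.exp ((-(Complex.I * t)) • (spectralMeasure A).cutOp n)
        ((spectralMeasure A).cutProj n φ) := by
  have h : (fun x : ℝ => Complex.exp (-(Complex.I * t * x))) =
      fun x : ℝ => Complex.exp (-(Complex.I * t) * x) := by
    ext x
    rw [neg_mul]
  have hC : ∀ x : ℝ, ‖Complex.exp (-(Complex.I * t) * x)‖ ≤ 1 := fun x => by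
    rw [show -(Complex.I * t) * x = ((-(t * x) : ℝ) : ℂ) * Complex.I by push_cast; ring,
      Complex.norm_exp_ofReal_mul_I]
  rw [← (spectralMeasure A).integral_exp_cutProj (-(Complex.I * t)) (by fun_prop) 1 hC]
  refine ext_inner_left ℂ fun ψ => ?_
  rw [expNegI, PVM.inner_integral, PVM.inner_integral, h]

lemma norm_expNegI_apply_le (A : H →ₗ.[ℂ] H) (t : ℝ) (φ : H) :
    ‖expNegI A t φ‖ ≤ 2 * ‖φ‖ := by
  refine ((spectralMeasure A).norm_integral_apply_le _ (C := 1) _ φ).trans_eq ?_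
  rw [mul_one]

/-- On the range of a cutoff `P`, with `A P = B` bounded, the exponential of `A` is that of `B`. -/
lemma expNegI_apply_of_cutoff {A : H →ₗ.[ℂ] H} (hA : IsSelfAdjoint A) {P B : H →L[ℂ] H}
    (hAP : ∀ u, (P u, B u) ∈ A.graph) (hPB : P * B = B) (hBP : B * P = B) (t : ℝ) (u : H) :
    expNegI A t (P u) = NormedSpace.exp ((-(Complex.I * t)) • B) (P u) := by
  let : NormedAlgebra ℚ (H →L[ℂ] H) := NormedAlgebra.restrictScalars ℚ ℂ _
  set F := spectralMeasure A with hF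
  have hFA : F.IsSpectralMeasureOf A := isSpectralMeasureOf_spectralMeasure hA
  set z : ℂ := -(Complex.I * t) with hz
  have h1 : ∀ m v, F.cutProj m (B v) = F.cutOp m (P v) := by
    intro m v
    obtain ⟨y, hy1, hy2⟩ := (LinearPMap.mem_graph_iff A).1 (hAP v)
    have h := hFA.cutProj_apply hA m y
    rwa [hy1, hy2] at h
  have hcomm : Commute P (NormedSpace.exp (z • B)) := by
    have h : SemiconjBy P (z • B) (z • B) := by
      rw [SemiconjBy, mul_smul_comm, smul_mul_assoc, hPB, hBP]
    exact h.exp_right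
  have h2 : ∀ m, F.cutProj m (NormedSpace.exp (z • B) (P u)) =
      expNegI A t (F.cutProj m (P u)) := by
    intro m
    have h : SemiconjBy (F.cutProj m * P) (z • B) (z • F.cutOp m) := by
      rw [SemiconjBy, mul_smul_comm, smul_mul_assoc]
      congr 1
      ext v
      have h3 : P (B v) = B v := DFunLike.congr_fun hPB v
      simp only [mul_apply_eq_comp]
      rw [h3, h1, F.cutOp_cutProj]
    have h4 := DFunLike.congr_fun h.exp_right.eq u
    have h5 : P (NormedSpace.exp (z • B) u) = NormedSpace.exp (z • B) (P u) :=
      DFunLike.congr_fun hcomm.eq u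
    simp only [mul_apply_eq_comp] at h4
    rw [h5] at h4
    rw [h4, hF, expNegI_cutProj]
  refine tendsto_nhds_unique ?_ (F.tendsto_cutProj _)
  simp only [h2]
  exact ((expNegI A t).continuous.tendsto _).comp (F.tendsto_cutProj (P u))

lemma hasSum_inner_expNegI_of_cutoff {A : H →ₗ.[ℂ] H} (hA : IsSelfAdjoint A) {P B : H →L[ℂ] H}
    (hAP : ∀ u, (P u, B u) ∈ A.graph) (hPB : P * B = B) (hBP : B * P = B) (t : ℝ) (w u : H) :
    HasSum (fun k : ℕ => (k.factorial : ℂ)⁻¹ * (-(Complex.I * t)) ^ k *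
      inner ℂ w ((B ^ k) (P u))) (inner ℂ w (expNegI A t (P u))) := by
  rw [expNegI_apply_of_cutoff hA hAP hPB hBP]
  exact hasSum_inner_exp_smul B _ w _

end Exponential

section TensorMap

variable {H : Type u} [NormedAddCommGroup H] [InnerProductSpace ℂ H]
  {K : Type v} [NormedAddCommGroup K] [InnerProductSpace ℂ K]

lemma hilbertTmul_eq_coe (ψ : H) (φ : K) :
    hilbertTmul ψ φ = ((ψ ⊗ₜ[ℂ] φ : H ⊗[ℂ] K) : HilbertTensor H K) := rfl

lemma inner_hilbertTmul (ψ ψ' : H) (φ φ' : K) :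
    inner ℂ (hilbertTmul ψ φ) (hilbertTmul ψ' φ') = inner ℂ ψ ψ' * inner ℂ φ φ' := by
  rw [hilbertTmul_eq_coe, hilbertTmul_eq_coe, UniformSpace.Completion.inner_coe,
    TensorProduct.inner_tmul]

/-- Bounded operators on the Hilbert space tensor product are determined by elementary tensors. -/
lemma hilbertTensor_ext {G : Type*} [NormedAddCommGroup G] [NormedSpace ℂ G]
    {S T : HilbertTensor H K →L[ℂ] G}
    (h : ∀ ψ φ, S (hilbertTmul ψ φ) = T (hilbertTmul ψ φ)) : S = T := by
  ext u
  induction u using UniformSpace.Completion.induction_on with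
  | hp => exact isClosed_eq S.continuous T.continuous
  | ih t =>
    induction t using TensorProduct.induction_on with
    | zero => rw [UniformSpace.Completion.coe_zero, map_zero, map_zero]
    | tmul ψ φ => exact h ψ φ
    | add x y hx hy => rw [UniformSpace.Completion.coe_add, map_add, map_add, hx, hy]

lemma hilbertTensor_eq_of_inner {u v : HilbertTensor H K}
    (h : ∀ ψ φ, inner ℂ (hilbertTmul ψ φ) u = inner ℂ (hilbertTmul ψ φ) v) : u = v := by
  have h1 : innerSL ℂ (u - v) = 0 := hilbertTensor_ext fun ψ φ => by
    have h2 : inner ℂ (hilbertTmul ψ φ) (u - v) = 0 := by rw [inner_sub_right, h, sub_self]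
    rw [innerSL_apply_apply, zero_apply, ← inner_conj_symm, h2, map_zero]
  exact sub_eq_zero.1 (inner_self_eq_zero.1 (DFunLike.congr_fun h1 (u - v)))

/-- The tensor product of two bounded operators. -/
noncomputable def tensorMap (A : H →L[ℂ] H) (B : K →L[ℂ] K) :
    HilbertTensor H K →L[ℂ] HilbertTensor H K := (TensorProduct.mapL A B).completion

lemma tensorMap_hilbertTmul (A : H →L[ℂ] H) (B : K →L[ℂ] K) (ψ : H) (φ : K) :
    tensorMap A B (hilbertTmul ψ φ) = hilbertTmul (A ψ) (B φ) :=
  ContinuousLinearMap.completion_apply_coe _ _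

lemma tensorMap_mul (A A' : H →L[ℂ] H) (B B' : K →L[ℂ] K) :
    tensorMap A B * tensorMap A' B' = tensorMap (A * A') (B * B') :=
  hilbertTensor_ext fun ψ φ => by
    rw [mul_apply_eq_comp, tensorMap_hilbertTmul, tensorMap_hilbertTmul, tensorMap_hilbertTmul]
    rfl

lemma tensorMap_pow_hilbertTmul (A : H →L[ℂ] H) (B : K →L[ℂ] K) (k : ℕ) (ψ : H) (φ : K) :
    (tensorMap A B ^ k) (hilbertTmul ψ φ) = hilbertTmul ((A ^ k) ψ) ((B ^ k) φ) := by
  induction k with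
  | zero => simp
  | succ k ih =>
    rw [pow_succ', mul_apply_eq_comp, ih, tensorMap_hilbertTmul, pow_succ', pow_succ']
    rfl

lemma inner_tensorMap_left {A : H →L[ℂ] H} {B : K →L[ℂ] K}
    (hA : ∀ ψ ψ', inner ℂ (A ψ) ψ' = inner ℂ ψ (A ψ'))
    (hB : ∀ φ φ', inner ℂ (B φ) φ' = inner ℂ φ (B φ')) (u v : HilbertTensor H K) :
    inner ℂ (tensorMap A B u) v = inner ℂ u (tensorMap A B v) := by
  have h1 : ∀ ψ φ, inner ℂ (tensorMap A B (hilbertTmul ψ φ)) v =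
      inner ℂ (hilbertTmul ψ φ) (tensorMap A B v) := by
    intro ψ φ
    have h : innerSL ℂ (tensorMap A B (hilbertTmul ψ φ)) =
        innerSL ℂ (hilbertTmul ψ φ) ∘L tensorMap A B := hilbertTensor_ext fun ψ' φ' => by
      rw [innerSL_apply_apply, ContinuousLinearMap.comp_apply, innerSL_apply_apply,
        tensorMap_hilbertTmul, tensorMap_hilbertTmul, inner_hilbertTmul, inner_hilbertTmul, hA, hB]
    exact DFunLike.congr_fun h v
  have h2 : innerSL ℂ v ∘L tensorMap A B = innerSL ℂ (tensorMap A B v) :=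
    hilbertTensor_ext fun ψ φ => by
      have h3 := congrArg (starRingEnd ℂ) (h1 ψ φ)
      rwa [inner_conj_symm, inner_conj_symm] at h3
  have h3 : inner ℂ v (tensorMap A B u) = inner ℂ (tensorMap A B v) u :=
    DFunLike.congr_fun h2 u
  rw [← inner_conj_symm, h3, inner_conj_symm]

lemma norm_tensorMap_apply_le (A : H →L[ℂ] H) (B : K →L[ℂ] K) (u : HilbertTensor H K) :
    ‖tensorMap A B u‖ ≤ ‖A‖ * ‖B‖ * ‖u‖ := by
  induction u using UniformSpace.Completion.induction_on with
  | hp => exact isClosed_le (by fun_prop) (by fun_prop)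
  | ih t =>
    rw [tensorMap, ContinuousLinearMap.completion_apply_coe, UniformSpace.Completion.norm_coe,
      UniformSpace.Completion.norm_coe]
    exact ((TensorProduct.mapL A B).le_opNorm t).trans
      (by gcongr; exact TensorProduct.norm_mapL_le A B)

lemma tendsto_tensorMap {A : ℕ → H →L[ℂ] H} {B : ℕ → K →L[ℂ] K}
    (hA : ∀ ψ, Tendsto (fun n => A n ψ) atTop (𝓝 ψ))
    (hB : ∀ φ, Tendsto (fun n => B n φ) atTop (𝓝 φ))
    (hA1 : ∀ n, ‖A n‖ ≤ 1) (hB1 : ∀ n, ‖B n‖ ≤ 1) (u : HilbertTensor H K) :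
    Tendsto (fun n => tensorMap (A n) (B n) u) atTop (𝓝 u) := by
  have halg : ∀ t : H ⊗[ℂ] K, Tendsto (fun n => tensorMap (A n) (B n) (t : HilbertTensor H K))
      atTop (𝓝 (t : HilbertTensor H K)) := by
    intro t
    induction t using TensorProduct.induction_on with
    | zero => simpa only [UniformSpace.Completion.coe_zero, map_zero] using tendsto_const_nhds
    | tmul ψ φ =>
      have h1 := ((TensorProduct.continuous_tmul (𝕜 := ℂ) (E := H) (F := K)).tendsto
        (ψ, φ)).comp ((hA ψ).prodMk_nhds (hB φ))
      refine (((UniformSpace.Completion.continuous_coe (H ⊗[ℂ] K)).tendsto _).comp h1).congr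
        fun n => ?_
      exact (tensorMap_hilbertTmul (A n) (B n) ψ φ).symm
    | add x y hx hy => simpa only [UniformSpace.Completion.coe_add, map_add] using hx.add hy
  have hle : ∀ n v, ‖tensorMap (A n) (B n) v‖ ≤ ‖v‖ := fun n v =>
    (norm_tensorMap_apply_le _ _ v).trans (by
      have h : ‖A n‖ * ‖B n‖ ≤ 1 := mul_le_one₀ (hA1 n) (norm_nonneg _) (hB1 n)
      nlinarith [norm_nonneg v])
  rw [Metric.tendsto_nhds]
  intro ε hε
  obtain ⟨t, ht⟩ := Metric.denseRange_iff.1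
    (UniformSpace.Completion.denseRange_coe (α := H ⊗[ℂ] K)) u (ε / 3) (by positivity)
  filter_upwards [Metric.tendsto_nhds.1 (halg t) (ε / 3) (by positivity)] with n hn
  have h1 : dist (tensorMap (A n) (B n) u) (tensorMap (A n) (B n) (t : HilbertTensor H K)) ≤
      dist u t := by
    rw [dist_eq_norm, dist_eq_norm, ← map_sub]
    exact hle n _
  have h2 := dist_triangle4 (tensorMap (A n) (B n) u)
    (tensorMap (A n) (B n) (t : HilbertTensor H K)) t u
  rw [dist_comm (t : HilbertTensor H K) u] at h2
  linarith

end TensorMap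

section WeakIntegral

variable {H : Type u} [NormedAddCommGroup H] [InnerProductSpace ℂ H]
  {K : Type v} [NormedAddCommGroup K] [InnerProductSpace ℂ K]

lemma algTensor_tensorDomainIncl (X : H →ₗ.[ℂ] H) (Y : K →ₗ.[ℂ] K) (t : X.domain ⊗[ℂ] Y.domain) :
    algTensor X Y ⟨tensorDomainIncl X Y t, LinearMap.mem_range.2 ⟨t, rfl⟩⟩ =
      ((TensorProduct.map X.toFun Y.toFun t : H ⊗[ℂ] K) : HilbertTensor H K) := by
  have h : (LinearEquiv.ofInjective (tensorDomainIncl X Y).toLinearMap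
      (fun _ _ h => (tensorDomainIncl X Y).injective h)).symm
      ⟨tensorDomainIncl X Y t, LinearMap.mem_range.2 ⟨t, rfl⟩⟩ = t := by
    rw [LinearEquiv.symm_apply_eq]; rfl
  change UniformSpace.Completion.toComplₗᵢ (𝕜 := ℂ) (TensorProduct.map X.toFun Y.toFun _) = _
  erw [h]
  rfl

variable [CompleteSpace H] [CompleteSpace K] {E : PVM H} {F : PVM K} {X : H →ₗ.[ℂ] H} {Y : K →ₗ.[ℂ] K}

lemma tensorMap_cutProj_algTensor (hE : E.IsSpectralMeasureOf X) (hX : IsSelfAdjoint X)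
    (hF : F.IsSpectralMeasureOf Y) (hY : IsSelfAdjoint Y) (n : ℕ) (u : (algTensor X Y).domain) :
    tensorMap (E.cutProj n) (F.cutProj n) (algTensor X Y u) =
      tensorMap (E.cutOp n) (F.cutOp n) (u : HilbertTensor H K) := by
  obtain ⟨u, t, rfl⟩ := u
  refine (congrArg _ (algTensor_tensorDomainIncl X Y t)).trans ?_
  change _ = tensorMap (E.cutOp n) (F.cutOp n) (tensorDomainIncl X Y t)
  induction t using TensorProduct.induction_on with
  | zero =>
    rw [map_zero, UniformSpace.Completion.coe_zero, map_zero]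
    exact (map_zero (tensorMap (E.cutOp n) (F.cutOp n))).symm.trans
      (congrArg _ (tensorDomainIncl X Y).map_zero.symm)
  | tmul ψ φ =>
    have h1 := tensorMap_hilbertTmul (E.cutProj n) (F.cutProj n) (X ψ) (Y φ)
    rw [hE.cutProj_apply hX, hF.cutProj_apply hY] at h1
    exact h1.trans (tensorMap_hilbertTmul (E.cutOp n) (F.cutOp n) (ψ : H) (φ : K)).symm
  | add x y hx hy =>
    rw [map_add, map_add, map_add, UniformSpace.Completion.coe_add, map_add, hx, hy]

lemma tensorMap_cutProj_mem_graph (hE : E.IsSpectralMeasureOf X) (hF : F.IsSpectralMeasureOf Y)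
    (n : ℕ) (t : H ⊗[ℂ] K) :
    (tensorMap (E.cutProj n) (F.cutProj n) (t : HilbertTensor H K),
      tensorMap (E.cutOp n) (F.cutOp n) (t : HilbertTensor H K)) ∈ (algTensor X Y).graph := by
  induction t using TensorProduct.induction_on with
  | zero =>
    rw [UniformSpace.Completion.coe_zero, map_zero, map_zero]
    exact zero_mem _
  | tmul ψ φ =>
    have h := algTensor_hilbertTmul X Y ⟨E.cutProj n ψ, hE.cutProj_mem n ψ⟩
      ⟨F.cutProj n φ, hF.cutProj_mem n φ⟩
    rw [hE.apply_cutProj, hF.apply_cutProj] at h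
    rw [← hilbertTmul_eq_coe, tensorMap_hilbertTmul, tensorMap_hilbertTmul]
    exact (LinearPMap.mem_graph_iff _).2 ⟨_, rfl, h⟩
  | add x y hx hy =>
    rw [UniformSpace.Completion.coe_add, map_add, map_add]
    exact add_mem hx hy

lemma PVM.cutProj_mul_cutOp (E : PVM H) (n : ℕ) : E.cutProj n * E.cutOp n = E.cutOp n :=
  ContinuousLinearMap.ext (E.cutProj_cutOp n)

lemma PVM.cutOp_mul_cutProj (E : PVM H) (n : ℕ) : E.cutOp n * E.cutProj n = E.cutOp n :=
  ContinuousLinearMap.ext (E.cutOp_cutProj n)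

lemma PVM.norm_cutProj_le (n : ℕ) : ‖E.cutProj n‖ ≤ 1 := (E.isStarProjection _).norm_le

lemma PVM.inner_cutOp_left (n : ℕ) (ψ φ : H) :
    inner ℂ (E.cutOp n ψ) φ = inner ℂ ψ (E.cutOp n φ) :=
  ContinuousLinearMap.isSelfAdjoint_iff_isSymmetric.1 (E.isSelfAdjoint_cutOp n) ψ φ

lemma tendsto_tensorMap_cutProj (u : HilbertTensor H K) :
    Tendsto (fun n => tensorMap (E.cutProj n) (F.cutProj n) u) atTop (𝓝 u) :=
  tendsto_tensorMap E.tendsto_cutProj F.tendsto_cutProj (fun _ => PVM.norm_cutProj_le _)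
    (fun _ => PVM.norm_cutProj_le _) u

lemma isSelfAdjoint_tensorOp_and_graph (hE : E.IsSpectralMeasureOf X) (hX : IsSelfAdjoint X)
    (hF : F.IsSpectralMeasureOf Y) (hY : IsSelfAdjoint Y) :
    IsSelfAdjoint (tensorOp X Y) ∧ ∀ n u, (tensorMap (E.cutProj n) (F.cutProj n) u,
      tensorMap (E.cutOp n) (F.cutOp n) u) ∈ (tensorOp X Y).graph :=
  LinearPMap.isSelfAdjoint_closure_of_cutoffs
    (D := Set.range fun t : H ⊗[ℂ] K => (t : HilbertTensor H K))
    UniformSpace.Completion.denseRange_coe tendsto_tensorMap_cutProj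
    (fun n => inner_tensorMap_left (E.inner_cutProj_left n) (F.inner_cutProj_left n))
    (fun n => inner_tensorMap_left (PVM.inner_cutOp_left n) (PVM.inner_cutOp_left n))
    (tensorMap_cutProj_algTensor hE hX hF hY)
    (by
      rintro n _ ⟨t, rfl⟩
      exact tensorMap_cutProj_mem_graph hE hF n t)

/-- The tensor product of two self-adjoint operators is self-adjoint. -/
theorem isSelfAdjoint_tensorOp (hX : IsSelfAdjoint X) (hY : IsSelfAdjoint Y) :
    IsSelfAdjoint (tensorOp X Y) :=
  (isSelfAdjoint_tensorOp_and_graph (isSpectralMeasureOf_spectralMeasure hX) hX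
    (isSpectralMeasureOf_spectralMeasure hY) hY).1

lemma hasSum_inner_expNegI_tensorOp_cutProj (hX : IsSelfAdjoint X) (hY : IsSelfAdjoint Y) (t : ℝ)
    (n : ℕ) (w u : HilbertTensor H K) :
    HasSum (fun k : ℕ => (k.factorial : ℂ)⁻¹ * (-(Complex.I * t)) ^ k *
      inner ℂ w ((tensorMap ((spectralMeasure X).cutOp n) ((spectralMeasure Y).cutOp n) ^ k)
        (tensorMap ((spectralMeasure X).cutProj n) ((spectralMeasure Y).cutProj n) u)))
      (inner ℂ w (expNegI (tensorOp X Y) t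
        (tensorMap ((spectralMeasure X).cutProj n) ((spectralMeasure Y).cutProj n) u))) := by
  obtain ⟨h1, h2⟩ := isSelfAdjoint_tensorOp_and_graph (isSpectralMeasureOf_spectralMeasure hX) hX
    (isSpectralMeasureOf_spectralMeasure hY) hY
  refine hasSum_inner_expNegI_of_cutoff h1 (h2 n) ?_ ?_ t w u
  · rw [tensorMap_mul, PVM.cutProj_mul_cutOp, PVM.cutProj_mul_cutOp]
  · rw [tensorMap_mul, PVM.cutOp_mul_cutProj, PVM.cutOp_mul_cutProj]

lemma measurable_inner_expNegI_cutProj (X : H →ₗ.[ℂ] H) (n : ℕ) (ψ₁ ψ₂ : H) :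
    Measurable fun y : ℝ =>
      (inner ℂ ψ₁ (expNegI X y ((spectralMeasure X).cutProj n ψ₂)) : ℂ) := by
  let : NormedAlgebra ℚ (H →L[ℂ] H) := NormedAlgebra.restrictScalars ℚ ℂ _
  simp only [expNegI_cutProj]
  refine Continuous.measurable (continuous_const.inner ?_)
  refine Continuous.clm_apply (NormedSpace.exp_continuous.comp ?_) continuous_const
  fun_prop

lemma tendsto_inner_expNegI_cutProj (X : H →ₗ.[ℂ] H) (ψ₁ ψ₂ : H) (y : ℝ) :
    Tendsto (fun n => (inner ℂ ψ₁ (expNegI X y ((spectralMeasure X).cutProj n ψ₂)) : ℂ)) atTop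
      (𝓝 (inner ℂ ψ₁ (expNegI X y ψ₂))) :=
  tendsto_const_nhds.inner
    (((expNegI X y).continuous.tendsto _).comp ((spectralMeasure X).tendsto_cutProj ψ₂))

lemma measurable_inner_expNegI (X : H →ₗ.[ℂ] H) (ψ₁ ψ₂ : H) :
    Measurable fun y : ℝ => (inner ℂ ψ₁ (expNegI X y ψ₂) : ℂ) :=
  measurable_of_tendsto_metrizable (fun n => measurable_inner_expNegI_cutProj X n ψ₁ ψ₂)
    (tendsto_pi_nhds.2 (tendsto_inner_expNegI_cutProj X ψ₁ ψ₂))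

lemma norm_inner_expNegI_le (X : H →ₗ.[ℂ] H) (ψ₁ ψ₂ : H) (y : ℝ) :
    ‖(inner ℂ ψ₁ (expNegI X y ψ₂) : ℂ)‖ ≤ ‖ψ₁‖ * (2 * ‖ψ₂‖) :=
  (norm_inner_le_norm _ _).trans (by gcongr; exact norm_expNegI_apply_le X y ψ₂)

lemma inner_expNegI_tensorOp_cutProj (hX : IsSelfAdjoint X) (hY : IsSelfAdjoint Y) (n : ℕ)
    (ψ₁ ψ₂ : H) (φ₁ φ₂ : K) :
    inner ℂ (hilbertTmul ψ₁ φ₁) (expNegI (tensorOp X Y) 1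
      (tensorMap ((spectralMeasure X).cutProj n) ((spectralMeasure Y).cutProj n)
        (hilbertTmul ψ₂ φ₂))) =
    (spectralMeasure Y).form
      (fun y => inner ℂ ψ₁ (expNegI X y ((spectralMeasure X).cutProj n ψ₂))) φ₁
      ((spectralMeasure Y).cutProj n φ₂) := by
  set χ := (spectralMeasure X).cutProj n ψ₂ with hχ
  set A := (spectralMeasure X).cutOp n with hA
  let c : ℕ → ℂ := fun k => (k.factorial : ℂ)⁻¹ * (-Complex.I) ^ k * inner ℂ ψ₁ ((A ^ k) χ)
  have hle : ∀ k, ‖(A ^ k) χ‖ ≤ ‖A‖ ^ k * ‖χ‖ := by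
    intro k
    induction k with
    | zero => simp
    | succ k ih =>
      rw [pow_succ', mul_apply_eq_comp, pow_succ', mul_assoc]
      exact (A.le_opNorm _).trans (by gcongr)
  have hc : Summable fun k => ‖c k‖ * (n : ℝ) ^ k := by
    refine Summable.of_nonneg_of_le (fun k => by positivity) (fun k => ?_)
      ((PVM.summable_exp_coeff (-Complex.I) (‖A‖ * n)).mul_right (‖ψ₁‖ * ‖χ‖))
    calc ‖c k‖ * (n : ℝ) ^ k
        = ‖(k.factorial : ℂ)⁻¹ * (-Complex.I) ^ k‖ * ‖(inner ℂ ψ₁ ((A ^ k) χ) : ℂ)‖ * (n : ℝ) ^ k := by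
          rw [← norm_mul]
      _ ≤ ‖(k.factorial : ℂ)⁻¹ * (-Complex.I) ^ k‖ * (‖ψ₁‖ * (‖A‖ ^ k * ‖χ‖)) * (n : ℝ) ^ k := by
          gcongr
          exact (norm_inner_le_norm _ _).trans (by gcongr; exact hle k)
      _ = _ := by rw [mul_pow]; ring
  have hf : ∀ y : ℝ, HasSum (fun k => c k * (y : ℂ) ^ k) (inner ℂ ψ₁ (expNegI X y χ)) := by
    intro y
    rw [hχ, expNegI_cutProj, ← hχ, ← hA]
    have h := hasSum_inner_exp_smul A (-(Complex.I * y)) ψ₁ χ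
    refine Eq.mpr (congrArg (fun g => HasSum g _) (funext fun k => ?_)) h
    simp only [c]
    rw [← neg_mul, mul_pow]
    ring
  have h1 := (spectralMeasure Y).hasSum_form_cutProj n hc hf φ₁ φ₂
  have h2 := hasSum_inner_expNegI_tensorOp_cutProj hX hY 1 n (hilbertTmul ψ₁ φ₁)
    (hilbertTmul ψ₂ φ₂)
  refine h2.unique ?_
  refine Eq.mpr (congrArg (fun g => HasSum g _) (funext fun k => ?_)) h1
  rw [tensorMap_hilbertTmul, tensorMap_pow_hilbertTmul, inner_hilbertTmul, Complex.ofReal_one, mul_one]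
  simp only [c]
  ring

lemma inner_expNegI_tensorOp (hX : IsSelfAdjoint X) (hY : IsSelfAdjoint Y) (ψ₁ ψ₂ : H)
    (φ₁ φ₂ : K) :
    inner ℂ (hilbertTmul ψ₁ φ₁) (expNegI (tensorOp X Y) 1 (hilbertTmul ψ₂ φ₂)) =
    (spectralMeasure Y).form (fun y => inner ℂ ψ₁ (expNegI X y ψ₂)) φ₁ φ₂ := by
  have h1 : Tendsto (fun n => inner ℂ (hilbertTmul ψ₁ φ₁) (expNegI (tensorOp X Y) 1
      (tensorMap ((spectralMeasure X).cutProj n) ((spectralMeasure Y).cutProj n)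
        (hilbertTmul ψ₂ φ₂)))) atTop
      (𝓝 (inner ℂ (hilbertTmul ψ₁ φ₁) (expNegI (tensorOp X Y) 1 (hilbertTmul ψ₂ φ₂)))) :=
    tendsto_const_nhds.inner (((expNegI (tensorOp X Y) 1).continuous.tendsto _).comp
      (tendsto_tensorMap_cutProj _))
  refine tendsto_nhds_unique h1 ?_
  have h2 : ∀ n : ℕ, inner ℂ (hilbertTmul ψ₁ φ₁) (expNegI (tensorOp X Y) 1
      (tensorMap ((spectralMeasure X).cutProj n) ((spectralMeasure Y).cutProj n)
        (hilbertTmul ψ₂ φ₂))) =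
      (spectralMeasure Y).form ((Set.Icc (-(n : ℝ)) n).indicator fun y =>
        inner ℂ ψ₁ (expNegI X y ((spectralMeasure X).cutProj n ψ₂))) φ₁ φ₂ := fun n =>
    (inner_expNegI_tensorOp_cutProj hX hY n ψ₁ ψ₂ φ₁ φ₂).trans
      (PVM.form_proj_right _ _ measurableSet_Icc _ _)
  simp only [h2]
  refine PVM.tendsto_form _ (C := ‖ψ₁‖ * (2 * ‖ψ₂‖))
    (fun n => (measurable_inner_expNegI_cutProj X n ψ₁ ψ₂).indicator measurableSet_Icc)
    (fun n y => ?_) (fun y => ?_) φ₁ φ₂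
  · refine (norm_indicator_le_norm_self _ _).trans ((norm_inner_expNegI_le X ψ₁ _ y).trans ?_)
    gcongr
    exact PVM.norm_proj_apply_le _ _ _
  · refine (tendsto_inner_expNegI_cutProj X ψ₁ ψ₂ y).congr' ?_
    obtain ⟨N, hN⟩ := exists_nat_ge |y|
    filter_upwards [eventually_ge_atTop N] with n hn
    rw [Set.indicator_of_mem (PVM.Icc_neg_nat_mono hn (abs_le.1 hN))]

lemma PVM.IsSpectralMeasureOf.proj_realSpectrum (hE : E.IsSpectralMeasureOf X) (φ : H) :
    E.proj (realSpectrum X) φ = φ := by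
  have hm : MeasurableSet (realSpectrum X) := (isClosed_realSpectrum X).measurableSet
  have h1 : E.scalarMeasure φ (realSpectrum X) = E.scalarMeasure φ Set.univ := by
    rw [← measure_add_measure_compl hm, hE.scalarMeasure_compl_realSpectrum, add_zero]
  rw [scalarMeasure_apply E φ hm, scalarMeasure_univ,
    ENNReal.ofReal_eq_ofReal_iff (by positivity) (by positivity)] at h1
  have h2 := E.norm_sub_proj_sq (realSpectrum X) φ
  rw [h1, sub_self] at h2
  exact (sub_eq_zero.1 (norm_eq_zero.1 (pow_eq_zero_iff two_ne_zero |>.1 h2))).symm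

lemma isWeakTensorIntegral_expNegI_tensorOp (hX : IsSelfAdjoint X) (hY : IsSelfAdjoint Y) :
    IsWeakTensorIntegral (fun y => expNegI X y) (spectralMeasure Y) (realSpectrum Y)
      (expNegI (tensorOp X Y) 1) := by
  have hS : MeasurableSet (realSpectrum Y) := (isClosed_realSpectrum Y).measurableSet
  refine ⟨hS, fun ψ₁ ψ₂ φ₁ φ₂ => ⟨?_, ?_⟩⟩
  · exact (PVM.integrable_of_bounded _ (measurable_inner_expNegI X ψ₁ ψ₂)
      (norm_inner_expNegI_le X ψ₁ ψ₂) φ₁ φ₂).integrableOn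
  · rw [inner_expNegI_tensorOp hX hY, ← PVM.matrixElement_proj_right _ hS,
      (isSpectralMeasureOf_spectralMeasure hY).proj_realSpectrum]
    rfl

end WeakIntegral

theorem mainTheorem2 {H : Type*} [NormedAddCommGroup H] [InnerProductSpace ℂ H] [CompleteSpace H]
    {K : Type*} [NormedAddCommGroup K] [InnerProductSpace ℂ K] [CompleteSpace K]
    (X : H →ₗ.[ℂ] H) (Y : K →ₗ.[ℂ] K) (hX : IsSelfAdjoint X) (hY : IsSelfAdjoint Y) :
    IsSelfAdjoint (tensorOp X Y) ∧
    ∀ T : HilbertTensor H K →L[ℂ] HilbertTensor H K,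
      IsWeakTensorIntegral (fun y => expNegI X y) (spectralMeasure Y) (realSpectrum Y) T ↔
        T = expNegI (tensorOp X Y) 1 := by
  refine ⟨isSelfAdjoint_tensorOp hX hY, fun T => ⟨fun hT => ?_, fun hT => ?_⟩⟩
  · have hU := isWeakTensorIntegral_expNegI_tensorOp hX hY
    refine hilbertTensor_ext fun ψ₂ φ₂ => hilbertTensor_eq_of_inner fun ψ₁ φ₁ => ?_
    rw [(hT.2 ψ₁ ψ₂ φ₁ φ₂).2, (hU.2 ψ₁ ψ₂ φ₁ φ₂).2]
  · rw [hT]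
    exact isWeakTensorIntegral_expNegI_tensorOp hX hY
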